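/- Let $S^2\subset\mathbb R^3$ be the round unit sphere with complex structure $J_pu=p\times u$, and let $z$ be the stereographic coordinate on $S^2$. For a smooth map $\phi:S^2\to S^2$ let $E[\phi]=\frac12\int_{S^2}|d\phi|^2$ be the harmonic map energy, $\nabla^\phi$ the pullback of the Levi-Civita connection to $\phi^*TS^2$, and $\|V\|_{H^1}^2=\|V\|_{L^2}^2+\|\nabla^\phi V\|_{L^2}^2$; let $H^1(\phi^*TS^2)$ be the completion of the smooth sections in this norm. Let $\mathrm{Rat}_1$ be the set of maps $z\mapsto (az+b)/(cz+d)$, $a,b,c,d\in\mathbb C$, $ad-bc\neq0$. For $\phi\in\mathrm{Rat}_1$ let $\mathrm{Hess}_\phi$ be the second variation of $E$ at $\phi$, that is, $\mathrm{Hess}_\phi(X,Y)=\partial_s\partial_tE[\phi_{s,t}]|_{s=t=0}$ for a smooth variation $\phi_{s,t}$ of $\phi=\phi_{0,0}$ with $\partial_s\phi_{s,t}|_{0,0}=X$, $\partial_t\phi_{s,t}|_{0,0}=Y$; extend the quadratic form $\mathrm{Hess}_\phi(V,V)$ continuously from smooth sections to $H^1(\phi^*TS^2)$. Let $\ker\mathfrak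 D^\phi$ be the space of smooth sections $K$ of $\phi^*TS^2$ with $\nabla^\phi_{JX}K=J\nabla^\phi_XK$ for all tangent vectors $X$, and put $$\tau(\phi)=\inf\left\{\frac{\mathrm{Hess}_\phi(V,V)}{\|V\|_{H^1}^2}\;:\;0\neq V\in H^1(\phi^*TS^2),\ V\perp_{L^2}\ker\mathfrak D^\phi\right\}.$$ **Theorem 5.1** (global coercivity of the Hessian fails on $\mathrm{Rat}_1$). For the maps $\phi_\mu:z\mapsto\mu z$, $\mu>0$, $$\lim_{\mu\to\infty}\tau(\phi_\mu)=0.$$ Consequently there is no constant $c>0$ such that $\mathrm{Hess}_\phi(V,V)\ge c\,\|V\|_{H^1}^2$ for all $\phi\in\mathrm{Rat}_1$ and all $V\in H^1(\phi^*TS^2)$ with $V\perp_{L^2}\ker\mathfrak D^\phi$. -/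

import Mathlib

open MeasureTheory Filter Topology Metric
open scoped Manifold ContDiff RealInnerProductSpace

noncomputable section

namespace LumpHessian

/-- Euclidean three-space. -/
abbrev E3 : Type := EuclideanSpace ℝ (Fin 3)

instance factFinrankE3 : Fact (Module.finrank ℝ E3 = 2 + 1) := ⟨by simp⟩

/-- The round unit two-sphere. -/
abbrev S2 : Type := sphere (0 : E3) 1

/-- Smooth maps from the two-sphere to itself. -/
abbrev SphereMap : Type := ContMDiffMap (𝓡 2) (𝓡 2) S2 S2 ∞

/-- The area measure of the round sphere (total mass `4π`). -/
abbrev area : Measure S2 := (volume : Measure E3).toSphere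

/-- The standard basis vectors of `ℝ³`. -/
def basisVec (i : Fin 3) : E3 := EuclideanSpace.single i 1

/-- The cross product of `ℝ³`. -/
def cross (u v : E3) : E3 :=
  !₂[u 1 * v 2 - u 2 * v 1, u 2 * v 0 - u 0 * v 2, u 0 * v 1 - u 1 * v 0]

/-- The point of the sphere at which `z = ∞`. -/
def north : S2 := ⟨basisVec 2, by simp [basisVec]⟩

/-- The radial projection `x ↦ x / |x|` of `ℝ³ ∖ {0}` onto the sphere. -/
def radialProj (x : E3) : S2 :=
  if h : x = 0 then north else ⟨‖x‖⁻¹ • x, by simp [norm_smul, h]⟩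

/-- The derivative at `p`, in the direction `u`, of a vector valued function `V` on the sphere,
as the derivative of the extension of `V` which is constant along rays. For `u` tangent to the
sphere at `p` this is the usual derivative of `V` along `u`; for `u` normal to it, it is zero. -/
def tangDeriv (V : S2 → E3) (p : S2) (u : E3) : E3 :=
  fderiv ℝ (fun x => V (radialProj x)) (p : E3) u

/-- Orthogonal projection of `v` onto the tangent plane of the sphere at `q`. -/
def tangProj (q : S2) (v : E3) : E3 := v - ⟪(q : E3), v⟫ • (q : E3)

/-- Smooth sections of the pullback `φ^* TS²`: the fibre over `p` is the tangent plane of the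
sphere at `φ p`, which is the orthogonal complement of `φ p` in `ℝ³`. -/
structure SmoothSection (φ : SphereMap) where
  toFun : S2 → E3
  smooth : ContMDiff (𝓡 2) 𝓘(ℝ, E3) ∞ toFun
  tangent : ∀ p, ⟪((φ p : S2) : E3), toFun p⟫ = 0

/-- The pullback of the Levi-Civita connection: `∇^φ_u V` at the point `p`. -/
def covDeriv (φ : SphereMap) (V : S2 → E3) (p : S2) (u : E3) : E3 :=
  tangProj (φ p) (tangDeriv V p u)

/-- The covariant differential `∇^φ V`, as the triple of covariant derivatives along the vectors
of the standard basis of `ℝ³`. Since `∇^φ V` vanishes in the normal direction, its norm at `p`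
is the Hilbert-Schmidt norm of `∇^φ V` on the tangent plane at `p`. -/
def covGrad (φ : SphereMap) (V : S2 → E3) (p : S2) : PiLp 2 (fun _ : Fin 3 => E3) :=
  WithLp.toLp 2 (fun i => covDeriv φ V p (basisVec i))

theorem contDiffOn_comp_radialProj {V : S2 → E3} (hV : ContMDiff (𝓡 2) 𝓘(ℝ, E3) ∞ V) :
    ContDiffOn ℝ ∞ (fun x => V (radialProj x)) {0}ᶜ := by
  let U : TopologicalSpace.Opens E3 := ⟨{0}ᶜ, isOpen_compl_singleton⟩
  have h0 : ∀ x : U, (x : E3) ≠ 0 := fun x => x.2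
  have h1 : ContMDiff 𝓘(ℝ, E3) 𝓘(ℝ, E3) ∞ (fun x : U => ‖(x : E3)‖⁻¹ • (x : E3)) := by
    intro x
    rw [contMDiffAt_subtype_iff (f := fun x : E3 => ‖x‖⁻¹ • x), contMDiffAt_iff_contDiffAt]
    exact ((contDiffAt_norm ℝ (h0 x)).inv (norm_ne_zero_iff.2 (h0 x))).smul contDiffAt_id
  have h2 := ContMDiff.codRestrict_sphere (n := 2) h1
    (fun x => by simp [norm_smul, h0 x])
  have h3 := hV.comp h2
  intro x hx
  have h4 := h3 ⟨x, hx⟩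
  have h5 : ContMDiffAt 𝓘(ℝ, E3) 𝓘(ℝ, E3) ∞
      (fun y : U => (fun x => V (radialProj x)) (y : E3)) ⟨x, hx⟩ := by
    refine h4.congr_of_eventuallyEq (Eventually.of_forall fun y => ?_)
    simp [radialProj, h0 y, Set.codRestrict]
  rw [contMDiffAt_subtype_iff (f := fun x => V (radialProj x)), contMDiffAt_iff_contDiffAt] at h5
  exact h5.contDiffWithinAt

theorem continuous_tangDeriv {V : S2 → E3} (hV : ContMDiff (𝓡 2) 𝓘(ℝ, E3) ∞ V) (u : E3) :
    Continuous fun p => tangDeriv V p u := by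
  have h := (contDiffOn_comp_radialProj hV).continuousOn_fderiv_of_isOpen
    isOpen_compl_singleton (by simp)
  have h2 : Continuous fun p : S2 => fderiv ℝ (fun x => V (radialProj x)) (p : E3) :=
    h.comp_continuous continuous_subtype_val (fun p => by
      simpa using ne_zero_of_mem_unit_sphere p)
  exact h2.clm_apply continuous_const

theorem continuous_covGrad (φ : SphereMap) {V : S2 → E3}
    (hV : ContMDiff (𝓡 2) 𝓘(ℝ, E3) ∞ V) : Continuous (covGrad φ V) := by
  have hφ : Continuous fun p => ((φ p : S2) : E3) :=
    continuous_subtype_val.comp φ.contMDiff.continuous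
  refine (PiLp.continuous_toLp 2 _).comp (continuous_pi fun i => ?_)
  have h := continuous_tangDeriv hV (basisVec i)
  have h' : Continuous fun p => ⟪((φ p : S2) : E3), tangDeriv V p (basisVec i)⟫ := hφ.inner h
  exact h.sub (h'.smul hφ)

/-- Square integrable `ℝ³`-valued functions on the sphere. -/
abbrev L2Vec : Type := Lp E3 2 area

/-- Square integrable triples of `ℝ³`-valued functions on the sphere. -/
abbrev L2Grad : Type := Lp (PiLp 2 (fun _ : Fin 3 => E3)) 2 area

/-- The class of a smooth section in `L²`. -/
def SmoothSection.toL2 {φ : SphereMap} (V : SmoothSection φ) : L2Vec :=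
  ContinuousMap.toLp 2 area ℝ ⟨V.toFun, V.smooth.continuous⟩

/-- The class of the covariant differential of a smooth section in `L²`. -/
def SmoothSection.gradToL2 {φ : SphereMap} (V : SmoothSection φ) : L2Grad :=
  ContinuousMap.toLp 2 area ℝ ⟨covGrad φ V.toFun, continuous_covGrad φ V.smooth⟩

/-- The pair `(V, ∇^φ V)` for a smooth section `V`. -/
def SmoothSection.jet {φ : SphereMap} (V : SmoothSection φ) : L2Vec × L2Grad :=
  (V.toL2, V.gradToL2)

/-- The Sobolev space `H¹(φ^* TS²)`, the completion of the smooth sections in the `H¹` norm: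
a section `V` is recorded together with `∇^φ V`, and the completion is the closure of the
smooth sections in `L² × L²`. -/
def H1 (φ : SphereMap) : Set (L2Vec × L2Grad) := closure (Set.range (SmoothSection.jet (φ := φ)))

/-- The square of the `H¹` norm, `‖V‖² + ‖∇^φ V‖²`. -/
def h1NormSq (x : L2Vec × L2Grad) : ℝ := ‖x.1‖ ^ 2 + ‖x.2‖ ^ 2

/-- The harmonic map energy `½ ∫ |dψ|²` of a map from the sphere to the sphere in `ℝ³`. -/
def energy (ψ : S2 → E3) : ℝ := (1 / 2) * ∫ p, ∑ i, ‖tangDeriv ψ p (basisVec i)‖ ^ 2 ∂area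

/-- The map to the sphere obtained by moving `φ p` by the tangent vector `W p` and projecting
back radially. -/
def variation (φ : SphereMap) (W : S2 → E3) (p : S2) : E3 :=
  (radialProj (((φ p : S2) : E3) + W p) : S2)

/-- The Hessian of the energy at `φ` on smooth sections `X`, `Y`: the mixed second derivative of
the energy at `s = t = 0` along a two-parameter variation `φ_{s,t}` of `φ` through smooth maps
with `∂φ/∂s = X` and `∂φ/∂t = Y`. (At a critical point `φ` of the energy the value does not
depend on the variation.) -/
def hessian {φ : SphereMap} (X Y : SmoothSection φ) : ℝ :=
  deriv (fun s : ℝ => deriv (fun t : ℝ =>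
    energy (variation φ (s • X.toFun + t • Y.toFun))) 0) 0

/-- The quadratic form `Hess_φ(V, V)` on `H¹`: the continuous extension of the quadratic form on
smooth sections. -/
def hessianH1 (φ : SphereMap) (x : L2Vec × L2Grad) : ℝ :=
  limUnder (comap (SmoothSection.jet (φ := φ)) (𝓝 x)) fun V => hessian V V

/-- Smooth sections in the kernel of `(𝔇^φ V)(X) = ∇^φ_{JX} V - J ∇^φ_X V`, where the complex
structure of the sphere is `J_p u = p × u`. -/
def InKernel {φ : SphereMap} (K : SmoothSection φ) : Prop :=
  ∀ (p : S2) (u : E3), ⟪(p : E3), u⟫ = 0 →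
    covDeriv φ K.toFun p (cross p u) - cross (φ p : S2) (covDeriv φ K.toFun p u) = 0

/-- The `H¹` sections which are `L²` orthogonal to the kernel of `𝔇^φ`. -/
def kerPerp (φ : SphereMap) : Set (L2Vec × L2Grad) :=
  {x | x ∈ H1 φ ∧ ∀ K : SmoothSection φ, InKernel K → ⟪x.1, K.toL2⟫ = 0}

/-- The optimal coercivity constant: the infimum of `Hess_φ(V, V) / ‖V‖²_{H¹}` over the nonzero
`H¹` sections `V` which are `L²` orthogonal to the kernel of `𝔇^φ`. It is taken in the extended
reals, so that it is a genuine infimum. -/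
def tau (φ : SphereMap) : EReal :=
  ⨅ x ∈ {x | x ∈ kerPerp φ ∧ x ≠ 0}, ((hessianH1 φ x / h1NormSq x : ℝ) : EReal)

/-- The point of the sphere with stereographic coordinate `z` (projection from `north`):
`z = (x₁ + i x₂) / (1 - x₃) = cot(θ/2) e^{iϕ}`. -/
def ofStereo (z : ℂ) : S2 :=
  ⟨!₂[2 * z.re / (1 + Complex.normSq z), 2 * z.im / (1 + Complex.normSq z),
      (Complex.normSq z - 1) / (1 + Complex.normSq z)], by
    have h : 1 + Complex.normSq z ≠ 0 :=
      (add_pos_of_pos_of_nonneg one_pos (Complex.normSq_nonneg z)).ne'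
    rw [mem_sphere_zero_iff_norm, EuclideanSpace.norm_eq, Real.sqrt_eq_one]
    simp only [Fin.sum_univ_three, Real.norm_eq_abs, sq_abs]
    simp
    field_simp
    rw [Complex.normSq_apply]
    ring⟩

/-- `Rat₁`, the holomorphic maps of degree one: in the stereographic coordinate they are
`z ↦ (a z + b) / (c z + d)` with `a d - b c ≠ 0`. -/
def Rat1 : Set SphereMap :=
  {φ | ∃ a b c d : ℂ, a * d - b * c ≠ 0 ∧
    ∀ z : ℂ, c * z + d ≠ 0 → φ (ofStereo z) = ofStereo ((a * z + b) / (c * z + d))}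

theorem height_mem (p : S2) : (p : E3) 0 ^ 2 + (p : E3) 1 ^ 2 + (p : E3) 2 ^ 2 = 1 := by
  have h := p.2
  rw [mem_sphere_zero_iff_norm, EuclideanSpace.norm_eq, Real.sqrt_eq_one] at h
  simpa [Fin.sum_univ_three] using h

theorem lump_denom_pos {μ : ℝ} (hμ : 0 < μ) (p : S2) :
    0 < (1 - (p : E3) 2) + μ ^ 2 * (1 + (p : E3) 2) := by
  have h := height_mem p
  have h1 : (p : E3) 2 ≤ 1 := by nlinarith [sq_nonneg ((p : E3) 0), sq_nonneg ((p : E3) 1)]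
  have h2 : -1 ≤ (p : E3) 2 := by nlinarith [sq_nonneg ((p : E3) 0), sq_nonneg ((p : E3) 1)]
  have h3 : 0 < μ ^ 2 := by positivity
  rcases eq_or_lt_of_le h1 with h4 | h4
  · rw [h4]; linarith
  · nlinarith [mul_nonneg h3.le (by linarith : 0 ≤ 1 + (p : E3) 2)]

/-- The map `z ↦ μ z`, as a map into `ℝ³`. -/
def lumpFun (μ : ℝ) (p : S2) : E3 :=
  ((1 - (p : E3) 2) + μ ^ 2 * (1 + (p : E3) 2))⁻¹ •
    !₂[2 * μ * (p : E3) 0, 2 * μ * (p : E3) 1, μ ^ 2 * (1 + (p : E3) 2) - (1 - (p : E3) 2)]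

theorem lumpFun_mem {μ : ℝ} (hμ : 0 < μ) (p : S2) : lumpFun μ p ∈ sphere (0 : E3) 1 := by
  have h := height_mem p
  have hd := (lump_denom_pos hμ p).ne'
  rw [mem_sphere_zero_iff_norm, EuclideanSpace.norm_eq, Real.sqrt_eq_one]
  simp only [Fin.sum_univ_three, Real.norm_eq_abs, sq_abs]
  simp [lumpFun]
  field_simp
  linear_combination 4 * μ ^ 2 * h

theorem contMDiff_lumpFun {μ : ℝ} (hμ : 0 < μ) :
    ContMDiff (𝓡 2) 𝓘(ℝ, E3) ∞ (lumpFun μ) := by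
  let g : E3 → E3 := fun x => ((1 - x 2) + μ ^ 2 * (1 + x 2))⁻¹ •
    !₂[2 * μ * x 0, 2 * μ * x 1, μ ^ 2 * (1 + x 2) - (1 - x 2)]
  intro p
  have hg : ContDiffAt ℝ ∞ g (p : E3) := by
    have h1 : ContDiffAt ℝ ∞ (fun x : E3 => (1 - x 2) + μ ^ 2 * (1 + x 2)) (p : E3) := by
      fun_prop
    have h2 : ContDiffAt ℝ ∞ (fun x : E3 => !₂[2 * μ * x 0, 2 * μ * x 1,
        μ ^ 2 * (1 + x 2) - (1 - x 2)]) (p : E3) := by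
      rw [contDiffAt_euclidean]
      intro i
      fin_cases i <;> simp <;> fun_prop
    exact (h1.inv (lump_denom_pos hμ p).ne').smul h2
  exact hg.contMDiffAt.comp p (contMDiff_coe_sphere p)

/-- The map `φ_μ : z ↦ μ z` of the sphere to itself, for `μ > 0`. -/
def lump (μ : Set.Ioi (0 : ℝ)) : SphereMap :=
  ⟨Set.codRestrict (lumpFun μ) (sphere (0 : E3) 1) (lumpFun_mem μ.2),
    (contMDiff_lumpFun μ.2).codRestrict_sphere (lumpFun_mem μ.2)⟩

/-- In the stereographic coordinate `lump μ` is indeed `z ↦ μ z`. -/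
theorem lump_ofStereo (μ : Set.Ioi (0 : ℝ)) (z : ℂ) :
    lump μ (ofStereo z) = ofStereo ((μ : ℝ) * z) := by
  have hμ : 0 < (μ : ℝ) := μ.2
  have h : 1 + Complex.normSq z ≠ 0 :=
      (add_pos_of_pos_of_nonneg one_pos (Complex.normSq_nonneg z)).ne'
  have h' : 1 + (μ : ℝ) * μ * Complex.normSq z ≠ 0 :=
      (add_pos_of_pos_of_nonneg one_pos
        (mul_nonneg (mul_pos hμ hμ).le (Complex.normSq_nonneg z))).ne'
  have key : (1 - (ofStereo z : E3) 2) + (μ : ℝ) ^ 2 * (1 + (ofStereo z : E3) 2)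
      = 2 * (1 + (μ : ℝ) * μ * Complex.normSq z) / (1 + Complex.normSq z) := by
    simp [ofStereo]
    field_simp
    ring
  apply Subtype.ext
  change lumpFun μ (ofStereo z) = _
  rw [lumpFun, key]
  ext i
  fin_cases i <;> simp [ofStereo] <;> field_simp <;> ring

/-- The map `lump μ` fixes the point at infinity. -/
theorem lump_north (μ : Set.Ioi (0 : ℝ)) : lump μ north = north := by
  have hμ : 0 < (μ : ℝ) := μ.2
  apply Subtype.ext
  change lumpFun μ north = _
  ext i
  fin_cases i <;> simp [lumpFun, north, basisVec]
  field_simp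

end LumpHessian

end

/-! At a holomorphic map, integration by parts turns the second variation into half the squared `L²`
norm of `𝔇V` (`hessian_self_of_isHolomorphic`). It is therefore nonnegative, and for `V = g X` with
`X` in the kernel it equals `∫ |∇g|² |X|²` (`hessian_mulFun`). So a section that agrees with a
multiple of `X` where `φ_μ` concentrates, and is cut off slowly elsewhere, has small Hessian. The
difficulty is to keep it exactly orthogonal to the whole kernel.

Write `s` for the height of `p`, `q = φ_μ(p)`, `β = μ² - 1`, `d = lumpDenom μ s = 2 + β(1 + s)`, `ε
= 1 / log μ²`, and let `w` be the conformal factor `lumpDensity`. Take `X` to be `confSection`, a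
conformal field on the target pulled back by `φ_μ`. For `K` in the kernel, `⟨X, K⟩` and `⟨JX, K⟩`
satisfy a Cauchy-Riemann equation. Integrating it against any radial `H(s)` shows that `g X` is
orthogonal to `K` for `g = (1 - s²)H' - 2sH - 2(1 + q 2)H` (`integral_mul_inner_kernel`). In effect
`g X` lies in the range of the adjoint of `𝔇`.

The choice `H = d` gives `g = 4 - 8(1 + s) - 3β(1 + s)²`, close to `4` where `1 + s` is of order
`μ⁻²`, but its Hessian does not tend to zero. Multiplying `H` by the logarithmic cutoff `1 - ε
log(d/2)` makes the Hessian `O(ε)` (`hessian_testSection_le`).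

The denominator stays away from zero: nonnegativity of the Hessian gives `∫ |∇V|² ≥ ∫ w |V|²`, and
the weighted mass of the test section is at least `(16 - 768 ε)` times the area
(`le_h1NormSq_testSection`). Hence `0 ≤ τ(φ_μ) ≤ 1872 ε` for large `μ`, and `ε → 0`. A uniform
constant `c` would be a lower bound for every `τ(φ_μ)`, which is impossible. -/

noncomputable section

namespace LumpHessian

/-! ### Calculus on the sphere through extensions constant along rays. -/

variable {G : Type*} [NormedAddCommGroup G] [NormedSpace ℝ G]

/-- Smoothness of a function on the sphere, through its extension constant along rays. -/
def SphereSmooth (f : S2 → G) : Prop := ContDiffOn ℝ ∞ (fun x : E3 => f (radialProj x)) {0}ᶜ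

/-- The derivative along `u` of the extension of `f` which is constant along rays. -/
def sder (f : S2 → G) (p : S2) (u : E3) : G := fderiv ℝ (fun x => f (radialProj x)) (p : E3) u

theorem coe_ne_zero (p : S2) : (p : E3) ≠ 0 := ne_zero_of_mem_unit_sphere p

theorem norm_coe (p : S2) : ‖(p : E3)‖ = 1 := mem_sphere_zero_iff_norm.1 p.2

theorem inner_coe_self (p : S2) : ⟪(p : E3), (p : E3)⟫ = 1 := by
  rw [real_inner_self_eq_norm_sq, norm_coe, one_pow]

theorem radialProj_coe (p : S2) : radialProj (p : E3) = p := by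
  apply Subtype.ext
  simp [radialProj, coe_ne_zero p]

theorem coe_radialProj {x : E3} (hx : x ≠ 0) : (radialProj x : E3) = ‖x‖⁻¹ • x := by
  simp [radialProj, hx]

theorem contDiffOn_radialProj : ContDiffOn ℝ ∞ (fun x : E3 => (radialProj x : E3)) {0}ᶜ := by
  have h : ContDiffOn ℝ ∞ (fun x : E3 => ‖x‖⁻¹ • x) {0}ᶜ := fun x hx =>
    (((contDiffAt_norm ℝ hx).inv (norm_ne_zero_iff.2 hx)).smul contDiffAt_id).contDiffWithinAt
  exact h.congr fun x hx => coe_radialProj hx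

theorem compl_zero_mem_nhds (p : S2) : ({0}ᶜ : Set E3) ∈ 𝓝 (p : E3) :=
  isOpen_compl_singleton.mem_nhds (coe_ne_zero p)

theorem fderiv_radialProj (p : S2) (u : E3) :
    fderiv ℝ (fun x : E3 => (radialProj x : E3)) p u = u - ⟪(p : E3), u⟫ • (p : E3) := by
  have h1 : HasFDerivAt (fun x : E3 => ‖x‖ ^ 2) (2 • innerSL ℝ (p : E3)) (p : E3) :=
    (hasStrictFDerivAt_norm_sq (p : E3)).hasFDerivAt
  have h2 : HasFDerivAt (fun x : E3 => √(‖x‖ ^ 2)) (innerSL ℝ (p : E3)) (p : E3) :=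
    (h1.sqrt (by simp)).congr_fderiv (by ext v; simp)
  have h3 : HasFDerivAt (fun x : E3 => (√(‖x‖ ^ 2))⁻¹) (-innerSL ℝ (p : E3)) (p : E3) :=
    ((hasDerivAt_inv (x := √(‖(p : E3)‖ ^ 2)) (by simp)).comp_hasFDerivAt
      (p : E3) h2).congr_fderiv (by ext v; simp)
  have h4 := h3.smul (hasFDerivAt_id (𝕜 := ℝ) (p : E3))
  have h5 : (fun x : E3 => (radialProj x : E3)) =ᶠ[𝓝 (p : E3)]
      fun x => (√(‖x‖ ^ 2))⁻¹ • x := by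
    filter_upwards [compl_zero_mem_nhds p] with x hx
    rw [coe_radialProj hx, Real.sqrt_sq (norm_nonneg x)]
  have h6 : HasFDerivAt (fun x : E3 => (radialProj x : E3)) _ (p : E3) :=
    HasFDerivAt.congr_of_eventuallyEq h4 h5
  rw [h6.fderiv]
  simp [sub_eq_add_neg]

theorem SphereSmooth.differentiableAt {f : S2 → G} (hf : SphereSmooth f) (p : S2) :
    DifferentiableAt ℝ (fun x : E3 => f (radialProj x)) p :=
  (hf.contDiffAt (compl_zero_mem_nhds p)).differentiableAt (by simp)

theorem SphereSmooth.hasFDerivAt {f : S2 → G} (hf : SphereSmooth f) (p : S2) :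
    HasFDerivAt (fun x : E3 => f (radialProj x))
      (fderiv ℝ (fun x : E3 => f (radialProj x)) p) p :=
  (hf.differentiableAt p).hasFDerivAt

theorem sphereSmooth_of_contMDiff {f : S2 → E3} (hf : ContMDiff (𝓡 2) 𝓘(ℝ, E3) ∞ f) :
    SphereSmooth f := contDiffOn_comp_radialProj hf

theorem SphereSmooth.contMDiff {f : S2 → G} (hf : SphereSmooth f) :
    ContMDiff (𝓡 2) 𝓘(ℝ, G) ∞ f := by
  intro p
  have h := ((hf.contDiffAt (compl_zero_mem_nhds p)).contMDiffAt).comp p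
    (contMDiff_coe_sphere (n := 2) (m := ∞) p)
  refine h.congr_of_eventuallyEq (Eventually.of_forall fun y => ?_)
  simp [radialProj_coe]

theorem SphereSmooth.continuous {f : S2 → G} (hf : SphereSmooth f) : Continuous f :=
  hf.contMDiff.continuous

theorem sphereSmooth_comp_coe {F : E3 → G} (hF : ∀ p : S2, ContDiffAt ℝ ∞ F p) :
    SphereSmooth fun p => F p := fun x hx =>
  (ContDiffAt.comp x (hF (radialProj x)) (contDiffOn_radialProj.contDiffAt
    (isOpen_compl_singleton.mem_nhds hx))).contDiffWithinAt

theorem sphereSmooth_coe : SphereSmooth fun p : S2 => (p : E3) :=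
  sphereSmooth_comp_coe (F := fun x => x) fun _ => contDiffAt_id

theorem sphereSmooth_const (c : G) : SphereSmooth fun _ : S2 => c := contDiffOn_const

theorem SphereSmooth.comp_contDiffAt {H : Type*} [NormedAddCommGroup H] [NormedSpace ℝ H]
    {f : S2 → G} (hf : SphereSmooth f) {F : G → H} (hF : ∀ p, ContDiffAt ℝ ∞ F (f p)) :
    SphereSmooth fun p => F (f p) := fun x hx =>
  (ContDiffAt.comp x (hF (radialProj x)) (ContDiffOn.contDiffAt hf
    (isOpen_compl_singleton.mem_nhds hx))).contDiffWithinAt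

theorem SphereSmooth.sder {f : S2 → G} (hf : SphereSmooth f) (u : E3) :
    SphereSmooth fun p => sder f p u := by
  have h1 : ContDiffOn ℝ ∞ (fun x : E3 => fderiv ℝ (fun x : E3 => f (radialProj x)) x u) {0}ᶜ :=
    (ContDiffOn.fderiv_of_isOpen hf isOpen_compl_singleton (m := ∞) (by simp)).clm_apply
      contDiffOn_const
  exact h1.comp contDiffOn_radialProj fun x _ => coe_ne_zero _

/-- The chain rule. -/
theorem sder_comp {H : Type*} [NormedAddCommGroup H] [NormedSpace ℝ H]
    {f : S2 → G} (hf : SphereSmooth f) {F : G → H} (p : S2) (hF : DifferentiableAt ℝ F (f p))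
    (u : E3) : LumpHessian.sder (fun p => F (f p)) p u
      = fderiv ℝ F (f p) (LumpHessian.sder f p u) := by
  have h : HasFDerivAt F (fderiv ℝ F (f p)) (f (radialProj (p : E3))) := by
    rw [radialProj_coe]; exact hF.hasFDerivAt
  have h2 := HasFDerivAt.comp (p : E3) h (hf.hasFDerivAt p)
  simp only [LumpHessian.sder]
  rw [show (fun x : E3 => F (f (radialProj x))) = F ∘ fun x : E3 => f (radialProj x) from rfl,
    h2.fderiv]
  rfl

theorem sder_coe (p : S2) (u : E3) :
    sder (fun p : S2 => (p : E3)) p u = u - ⟪(p : E3), u⟫ • (p : E3) := fderiv_radialProj p u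

theorem sder_comp_coe {F : E3 → G} {p : S2} (hF : DifferentiableAt ℝ F p) (u : E3) :
    sder (fun p : S2 => F p) p u = fderiv ℝ F p (u - ⟪(p : E3), u⟫ • (p : E3)) := by
  rw [sder_comp sphereSmooth_coe p hF, sder_coe]

/-- Radial projection is idempotent, so the extension of `f` is unchanged by precomposing with it.
The chain rule then inserts the tangential projection in the direction. -/
theorem sder_congr_tangent {f : S2 → G} (hf : SphereSmooth f) (p : S2) (u : E3) :
    sder f p u = sder f p (u - ⟪(p : E3), u⟫ • (p : E3)) := by
  have h1 := hf.hasFDerivAt p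
  have h2 : HasFDerivAt (fun x : E3 => f (radialProj x))
      (fderiv ℝ (fun x : E3 => f (radialProj x)) p) ((radialProj (p : E3) : S2) : E3) := by
    rwa [radialProj_coe]
  have h3 : HasFDerivAt (fun x : E3 => (radialProj x : E3))
      (fderiv ℝ (fun x : E3 => (radialProj x : E3)) p) p :=
    (sphereSmooth_coe.differentiableAt p).hasFDerivAt
  have h4 := HasFDerivAt.comp (p : E3) h2 h3
  have h5 : ((fun x : E3 => f (radialProj x)) ∘ fun x : E3 => (radialProj x : E3))
      = fun x : E3 => f (radialProj x) := by
    funext x; simp [radialProj_coe]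
  rw [h5] at h4
  have h6 := h1.unique h4
  have h7 := congrArg (fun L => L u) h6
  simp only [ContinuousLinearMap.comp_apply, fderiv_radialProj] at h7
  exact h7

theorem sder_self {f : S2 → G} (hf : SphereSmooth f) (p : S2) : sder f p (p : E3) = 0 := by
  rw [sder_congr_tangent hf, inner_coe_self, one_smul, sub_self]
  simp [sder]

theorem sder_const (c : G) (p : S2) (u : E3) : sder (fun _ => c) p u = 0 := by
  simp [sder]

theorem SphereSmooth.add {f g : S2 → G} (hf : SphereSmooth f) (hg : SphereSmooth g) :
    SphereSmooth fun p => f p + g p := ContDiffOn.add hf hg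

theorem SphereSmooth.sub {f g : S2 → G} (hf : SphereSmooth f) (hg : SphereSmooth g) :
    SphereSmooth fun p => f p - g p := ContDiffOn.sub hf hg

theorem SphereSmooth.smul {c : S2 → ℝ} {f : S2 → G} (hc : SphereSmooth c) (hf : SphereSmooth f) :
    SphereSmooth fun p => c p • f p := ContDiffOn.smul hc hf

theorem SphereSmooth.mul {c f : S2 → ℝ} (hc : SphereSmooth c) (hf : SphereSmooth f) :
    SphereSmooth fun p => c p * f p := ContDiffOn.mul hc hf

theorem SphereSmooth.inner {f g : S2 → E3} (hf : SphereSmooth f) (hg : SphereSmooth g) :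
    SphereSmooth fun p => ⟪f p, g p⟫ := ContDiffOn.inner ℝ hf hg

theorem sder_add {f g : S2 → G} (hf : SphereSmooth f) (hg : SphereSmooth g) (p : S2) (u : E3) :
    sder (fun p => f p + g p) p u = sder f p u + sder g p u := by
  have h := (hf.hasFDerivAt p).add (hg.hasFDerivAt p)
  simp only [sder]
  exact congrArg (fun L => L u) h.fderiv

theorem sder_smul {c : S2 → ℝ} {f : S2 → G} (hc : SphereSmooth c) (hf : SphereSmooth f)
    (p : S2) (u : E3) :
    sder (fun p => c p • f p) p u = c p • sder f p u + sder c p u • f p := by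
  have h := (hc.hasFDerivAt p).smul (hf.hasFDerivAt p)
  have h2 := congrArg (fun L => L u) h.fderiv
  simp only [radialProj_coe] at h2
  exact h2

theorem sder_mul {c f : S2 → ℝ} (hc : SphereSmooth c) (hf : SphereSmooth f) (p : S2) (u : E3) :
    sder (fun p => c p * f p) p u = c p * sder f p u + sder c p u * f p :=
  sder_smul hc hf p u

theorem sder_inner {f g : S2 → E3} (hf : SphereSmooth f) (hg : SphereSmooth g) (p : S2) (u : E3) :
    sder (fun p => ⟪f p, g p⟫) p u = ⟪f p, sder g p u⟫ + ⟪sder f p u, g p⟫ := by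
  have h := (hf.hasFDerivAt p).inner ℝ (hg.hasFDerivAt p)
  have h2 := congrArg (fun L => L u) h.fderiv
  simpa [sder, radialProj_coe] using h2

/-- The cross product as a continuous bilinear map. -/
def crossL : E3 →L[ℝ] E3 →L[ℝ] E3 :=
  LinearMap.toContinuousLinearMap (LinearMap.toContinuousLinearMap.toLinearMap ∘ₗ
    LinearMap.mk₂ ℝ cross
      (fun a b c => by ext i; fin_cases i <;> simp [cross] <;> ring)
      (fun a b c => by ext i; fin_cases i <;> simp [cross] <;> ring)
      (fun a b c => by ext i; fin_cases i <;> simp [cross] <;> ring)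
      (fun a b c => by ext i; fin_cases i <;> simp [cross] <;> ring))

theorem crossL_apply (a b : E3) : crossL a b = cross a b := rfl

theorem SphereSmooth.cross {f g : S2 → E3} (hf : SphereSmooth f) (hg : SphereSmooth g) :
    SphereSmooth fun p => cross (f p) (g p) :=
  ContDiffOn.clm_apply (crossL.contDiff.comp_contDiffOn hf) hg

theorem sder_cross {f g : S2 → E3} (hf : SphereSmooth f) (hg : SphereSmooth g) (p : S2) (u : E3) :
    sder (fun p => cross (f p) (g p)) p u
      = cross (f p) (sder g p u) + cross (sder f p u) (g p) := by
  have h := crossL.hasFDerivAt_of_bilinear (hf.hasFDerivAt p) (hg.hasFDerivAt p)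
  have h2 := congrArg (fun L => L u) h.fderiv
  simpa [sder, radialProj_coe, crossL_apply] using h2

/-! ### Integration over the sphere: rotation invariance and the divergence theorem. -/

theorem integrable_of_continuous {G : Type*} [NormedAddCommGroup G] {f : S2 → G}
    (hf : Continuous f) : Integrable f area :=
  hf.integrable_of_hasCompactSupport (HasCompactSupport.of_compactSpace f)

/-- Differentiation under the integral over the sphere. -/
theorem hasDerivAt_integral_area {F F' : ℝ → S2 → ℝ} (hF : ∀ t, Continuous (F t))
    (hF' : Continuous (Function.uncurry F')) (hd : ∀ t p, HasDerivAt (F · p) (F' t p) t)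
    (t₀ : ℝ) :
    HasDerivAt (fun t => ∫ p, F t p ∂area) (∫ p, F' t₀ p ∂area) t₀ := by
  obtain ⟨C, hC⟩ := 
    ((isCompact_closedBall t₀ 1).prod (isCompact_univ (X := S2))).exists_bound_of_continuousOn
      hF'.continuousOn
  refine (hasDerivAt_integral_of_dominated_loc_of_deriv_le (closedBall_mem_nhds t₀ one_pos)
    (Eventually.of_forall fun t => (hF t).aestronglyMeasurable) (integrable_of_continuous (hF t₀))
    (F' := F') (bound := fun _ => C)
    (hF'.comp (Continuous.prodMk_right t₀)).aestronglyMeasurable ?_ (integrable_const C) ?_).2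
  · exact Eventually.of_forall fun p t ht => hC (t, p) ⟨ht, Set.mem_univ p⟩
  · exact Eventually.of_forall fun p t _ => hd t p

/-- A linear isometry acting on the sphere. -/
def sphereMap (R : E3 ≃ₗᵢ[ℝ] E3) (p : S2) : S2 := ⟨R p, by simp⟩

-- The area of a set is defined by the volume of the cone over it. A linear isometry maps cones to
-- cones and preserves volume.
open scoped Pointwise in
theorem measurePreserving_sphereMap (R : E3 ≃ₗᵢ[ℝ] E3) :
    MeasurePreserving (sphereMap R) area area := by
  have hm : Measurable (sphereMap R) :=
    (Continuous.subtype_mk (R.continuous.comp continuous_subtype_val) _).measurable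
  refine ⟨hm, ?_⟩
  ext s hs
  rw [Measure.map_apply hm hs, Measure.toSphere_apply' _ hs, Measure.toSphere_apply' _ (hm hs)]
  congr 1
  have h : Set.Ioo (0 : ℝ) 1 • ((↑) '' (sphereMap R ⁻¹' s) : Set E3)
      = R ⁻¹' (Set.Ioo (0 : ℝ) 1 • ((↑) '' s : Set E3)) := by
    ext x
    simp only [Set.mem_smul, Set.mem_image, Set.mem_preimage]
    constructor
    · rintro ⟨c, hc, _, ⟨p, hp, rfl⟩, rfl⟩
      exact ⟨c, hc, _, ⟨sphereMap R p, hp, rfl⟩, by simp [sphereMap]⟩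
    · rintro ⟨c, hc, _, ⟨p, hp, rfl⟩, hx⟩
      refine ⟨c, hc, _, ⟨sphereMap R.symm p, ?_, rfl⟩, ?_⟩
      · simpa [sphereMap] using hp
      · simp only [sphereMap]
        rw [← map_smul, hx, R.symm_apply_apply]
  rw [h]
  exact (R.measurePreserving).measure_preimage_equiv (f := R.toMeasurableEquiv) _

/-- Rodrigues' formula for the rotation by the angle `t` about the axis `e`. -/
def rodrigues (e : E3) (t : ℝ) : E3 →ₗ[ℝ] E3 :=
  Real.cos t • LinearMap.id + Real.sin t • (crossL e : E3 →ₗ[ℝ] E3)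
    + (1 - Real.cos t) • (innerSL ℝ e : E3 →ₗ[ℝ] ℝ).smulRight e

theorem rodrigues_apply (e : E3) (t : ℝ) (x : E3) : rodrigues e t x =
    Real.cos t • x + Real.sin t • cross e x + ((1 - Real.cos t) * ⟪e, x⟫) • e := by
  simp [rodrigues, crossL_apply, smul_smul]

theorem inner_eq_coord (a b : E3) : ⟪a, b⟫ = a 0 * b 0 + a 1 * b 1 + a 2 * b 2 := by
  simp [PiLp.inner_apply, Fin.sum_univ_three]
  ring

theorem norm_sq_eq_coord (a : E3) : ‖a‖ ^ 2 = a 0 ^ 2 + a 1 ^ 2 + a 2 ^ 2 := by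
  rw [← real_inner_self_eq_norm_sq, inner_eq_coord]
  ring

theorem norm_rodrigues {e : E3} (he : ‖e‖ = 1) (t : ℝ) (x : E3) : ‖rodrigues e t x‖ = ‖x‖ := by
  rw [← sq_eq_sq₀ (norm_nonneg _) (norm_nonneg _)]
  have h1 : e 0 ^ 2 + e 1 ^ 2 + e 2 ^ 2 = 1 := by rw [← norm_sq_eq_coord, he, one_pow]
  have h2 := Real.sin_sq_add_cos_sq t
  rw [norm_sq_eq_coord, norm_sq_eq_coord, rodrigues_apply, inner_eq_coord]
  simp [cross]
  generalize Real.sin t = s at *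
  generalize Real.cos t = c at *
  have h3 : s ^ 2 = 1 - c ^ 2 := by linarith
  have h4 : e 0 ^ 2 = 1 - e 1 ^ 2 - e 2 ^ 2 := by linarith
  ring_nf
  simp only [h3, h4, show e 0 ^ 3 = e 0 * e 0 ^ 2 by ring, show e 0 ^ 4 = (e 0 ^ 2) ^ 2 by ring]
  ring_nf

/-- The rotation by the angle `t` about the axis `e`. -/
def rotation {e : E3} (he : ‖e‖ = 1) (t : ℝ) : E3 ≃ₗᵢ[ℝ] E3 :=
  LinearIsometry.toLinearIsometryEquiv ⟨rodrigues e t, norm_rodrigues he t⟩ rfl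

theorem continuous_sphereMap (R : E3 ≃ₗᵢ[ℝ] E3) : Continuous (sphereMap R) :=
  Continuous.subtype_mk (R.continuous.comp continuous_subtype_val) _

theorem integral_comp_sphereMap (R : E3 ≃ₗᵢ[ℝ] E3) (f : S2 → ℝ) :
    ∫ p, f (sphereMap R p) ∂area = ∫ p, f p ∂area :=
  (measurePreserving_sphereMap R).integral_comp'
    (f := Homeomorph.toMeasurableEquiv ⟨⟨sphereMap R, sphereMap R.symm,
      fun p => by simp [sphereMap], fun p => by simp [sphereMap]⟩,
      continuous_sphereMap R, continuous_sphereMap R.symm⟩) f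

theorem SphereSmooth.continuous_fderiv {G : Type*} [NormedAddCommGroup G] [NormedSpace ℝ G]
    {f : S2 → G} (hf : SphereSmooth f) :
    Continuous fun p : S2 => fderiv ℝ (fun x : E3 => f (radialProj x)) (p : E3) :=
  (ContDiffOn.continuousOn_fderiv_of_isOpen hf isOpen_compl_singleton (by simp)).comp_continuous
    continuous_subtype_val coe_ne_zero

theorem SphereSmooth.continuous_sder {G : Type*} [NormedAddCommGroup G] [NormedSpace ℝ G]
    {f : S2 → G} (hf : SphereSmooth f) {Y : S2 → E3} (hY : Continuous Y) :
    Continuous fun p => LumpHessian.sder f p (Y p) :=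
  hf.continuous_fderiv.clm_apply hY

theorem sphereMap_rotation {e : E3} (he : ‖e‖ = 1) (t : ℝ) (p : S2) :
    (sphereMap (rotation he t) p : E3) = rodrigues e t p := rfl

theorem hasDerivAt_rodrigues (e x : E3) (t : ℝ) : HasDerivAt (fun t => rodrigues e t x)
    (-Real.sin t • x + Real.cos t • crossL e x + (Real.sin t * ⟪e, x⟫) • e) t := by
  simp only [rodrigues_apply, ← crossL_apply]
  have h1 := (Real.hasDerivAt_cos t).smul_const x
  have h2 := (Real.hasDerivAt_sin t).smul_const (crossL e x)
  have h3 := (((Real.hasDerivAt_cos t).const_sub 1).mul_const ⟪e, x⟫).smul_const e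
  rw [neg_neg] at h3
  exact (h1.add h2).add h3

theorem continuous_rotation {e : E3} (he : ‖e‖ = 1) :
    Continuous fun x : ℝ × S2 => sphereMap (rotation he x.1) x.2 := by
  refine Continuous.subtype_mk (f := fun x : ℝ × S2 => rodrigues e x.1 x.2) ?_ _
  simp only [rodrigues_apply, ← crossL_apply]
  fun_prop

theorem hasDerivAt_comp_rotation {e : E3} (he : ‖e‖ = 1) {f : S2 → ℝ} (hf : SphereSmooth f)
    (t : ℝ) (p : S2) : HasDerivAt (fun t => f (sphereMap (rotation he t) p))
      (sder f (sphereMap (rotation he t) p) (-Real.sin t • (p : E3) + Real.cos t • crossL e p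
        + (Real.sin t * ⟪e, (p : E3)⟫) • e)) t := by
  have h := HasFDerivAt.comp_hasDerivAt t (f := fun t => rodrigues e t (p : E3))
    (hf.hasFDerivAt (sphereMap (rotation he t) p)) (hasDerivAt_rodrigues e p t)
  simp only [Function.comp_def, ← sphereMap_rotation he, radialProj_coe] at h
  exact h

/-- The integral over the sphere of a derivative along an infinitesimal rotation vanishes. -/
theorem integral_sder_cross {e : E3} (he : ‖e‖ = 1) {f : S2 → ℝ} (hf : SphereSmooth f) :
    ∫ p, sder f p (cross e p) ∂area = 0 := by
  have hcr' : Continuous fun x : ℝ × S2 => -Real.sin x.1 • (x.2 : E3)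
      + Real.cos x.1 • crossL e x.2 + (Real.sin x.1 * ⟪e, (x.2 : E3)⟫) • e := by fun_prop
  have key := hasDerivAt_integral_area (F := fun t p => f (sphereMap (rotation he t) p))
    (F' := fun t p => sder f (sphereMap (rotation he t) p)
      (-Real.sin t • (p : E3) + Real.cos t • crossL e p + (Real.sin t * ⟪e, (p : E3)⟫) • e))
    (fun t => hf.continuous.comp (continuous_sphereMap _))
    ((hf.continuous_fderiv.comp (continuous_rotation he)).clm_apply hcr')
    (hasDerivAt_comp_rotation he hf) 0
  -- By invariance of the area the integral does not depend on the angle, so its derivative at angle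
  -- zero, which is the integral in question, vanishes.
  simp only [integral_comp_sphereMap] at key
  have h0 := key.unique (hasDerivAt_const 0 _)
  rw [← h0]
  congr 1
  funext p
  have e1 : sphereMap (rotation he 0) p = p :=
    Subtype.ext (by rw [sphereMap_rotation, rodrigues_apply]; simp)
  simp [e1, crossL_apply]

theorem sder_add_dir {G : Type*} [NormedAddCommGroup G] [NormedSpace ℝ G] (f : S2 → G) (p : S2)
    (u v : E3) : sder f p (u + v) = sder f p u + sder f p v := map_add _ _ _

theorem sder_smul_dir {G : Type*} [NormedAddCommGroup G] [NormedSpace ℝ G] (f : S2 → G) (p : S2)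
    (c : ℝ) (u : E3) : sder f p (c • u) = c • sder f p u := map_smul _ _ _

theorem sder_neg_dir {G : Type*} [NormedAddCommGroup G] [NormedSpace ℝ G] (f : S2 → G) (p : S2)
    (u : E3) : sder f p (-u) = -sder f p u := map_neg _ _

theorem norm_basisVec (i : Fin 3) : ‖basisVec i‖ = 1 := by simp [basisVec]

/-- The gradient of the height function `p ↦ p 2`. -/
def heightGrad (p : E3) : E3 := basisVec 2 - p 2 • p

/-- A vector as the sum of its components. -/
theorem eq_sum_basisVec (v : E3) : v = v 0 • basisVec 0 + v 1 • basisVec 1 + v 2 • basisVec 2 := by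
  ext i
  fin_cases i <;> simp [basisVec]

theorem contDiff_coord (i : Fin 3) : ContDiff ℝ ∞ fun x : E3 => x i := by fun_prop

theorem sphereSmooth_coord (i : Fin 3) : SphereSmooth fun p : S2 => (p : E3) i :=
  sphereSmooth_comp_coe (F := fun x => x i) fun _ => (contDiff_coord i).contDiffAt

theorem sder_coord (i : Fin 3) (p : S2) (u : E3) :
    sder (fun p : S2 => (p : E3) i) p u = u i - ⟪(p : E3), u⟫ * (p : E3) i := by
  have h : HasFDerivAt (fun x : E3 => x i) (EuclideanSpace.proj i : E3 →L[ℝ] ℝ) (p : E3) :=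
    (EuclideanSpace.proj i : E3 →L[ℝ] ℝ).hasFDerivAt
  rw [sder_comp_coe (F := fun x => x i) h.differentiableAt, h.fderiv]
  simp

/-- The divergence theorem on the sphere, for the field `f • heightGrad`. -/
theorem integral_div_heightGrad {f : S2 → ℝ} (hf : SphereSmooth f) :
    ∫ p, (sder f p (heightGrad p) - 2 * (p : E3) 2 * f p) ∂area = 0 := by
  have h0 := integral_sder_cross (norm_basisVec 0) (hf.mul (sphereSmooth_coord 1))
  have h1 := integral_sder_cross (norm_basisVec 1) (hf.mul (sphereSmooth_coord 0))
  have c0 := (hf.mul (sphereSmooth_coord 1)).continuous_sder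
    (Y := fun p => cross (basisVec 0) p)
    ((crossL (basisVec 0)).continuous.comp continuous_subtype_val)
  have c1 := (hf.mul (sphereSmooth_coord 0)).continuous_sder
    (Y := fun p => cross (basisVec 1) p)
    ((crossL (basisVec 1)).continuous.comp continuous_subtype_val)
  have h2 := integral_sub (integrable_of_continuous c0) (integrable_of_continuous c1)
  rw [h0, h1, sub_zero] at h2
  rw [← h2]
  congr 1
  funext p
  -- The height gradient is a combination of two rotation fields with coordinates as coefficients.
  -- Absorbing the coefficients into the functions being differentiated produces the extra term `-2
  -- s f`.
  have e0 : heightGrad p = (p : E3) 1 • cross (basisVec 0) p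
      + (-(p : E3) 0) • cross (basisVec 1) p := by
    have hp := height_mem p
    ext i
    fin_cases i <;> simp [heightGrad, cross, basisVec]
    · ring
    · ring
    · linear_combination -hp
  rw [e0, sder_add_dir, sder_smul_dir, sder_smul_dir, sder_mul hf (sphereSmooth_coord 1),
    sder_mul hf (sphereSmooth_coord 0), sder_coord, sder_coord, inner_eq_coord, inner_eq_coord]
  simp [cross, basisVec]
  ring

/-- The divergence theorem on the sphere, for the field `h(p 2) • heightGrad`. -/
theorem integral_div_height {h h' : ℝ → ℝ}
    (hs : ∀ s ∈ Set.Icc (-1 : ℝ) 1, ContDiffAt ℝ ∞ h s)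
    (hd : ∀ s ∈ Set.Icc (-1 : ℝ) 1, HasDerivAt h (h' s) s) :
    ∫ p : S2, ((1 - (p : E3) 2 ^ 2) * h' ((p : E3) 2) - 2 * (p : E3) 2 * h ((p : E3) 2)) ∂area
      = 0 := by
  have hI : ∀ p : S2, (p : E3) 2 ∈ Set.Icc (-1 : ℝ) 1 := fun p => by
    have h := height_mem p
    constructor <;> nlinarith [sq_nonneg ((p : E3) 0), sq_nonneg ((p : E3) 1)]
  rw [← integral_div_heightGrad ((sphereSmooth_coord 2).comp_contDiffAt fun p => hs _ (hI p))]
  congr 1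
  funext p
  rw [sder_comp (sphereSmooth_coord 2) p (hd _ (hI p)).differentiableAt, sder_coord,
    (hd _ (hI p)).hasFDerivAt.fderiv, inner_eq_coord]
  have hp := height_mem p
  simp [heightGrad, basisVec]
  exact Or.inl (by linear_combination (-(p : E3) 2 ^ 2) * hp)

/-! ### The second variation of the energy at an arbitrary map. -/

theorem SphereMap.sphereSmooth (φ : SphereMap) : SphereSmooth fun p => ((φ p : S2) : E3) :=
  sphereSmooth_of_contMDiff ((contMDiff_coe_sphere (n := 2) (m := ∞)).comp φ.contMDiff)

theorem SmoothSection.sphereSmooth {φ : SphereMap} (V : SmoothSection φ) :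
    SphereSmooth V.toFun := sphereSmooth_of_contMDiff V.smooth

theorem inner_sder_self_eq_zero (φ : SphereMap) (p : S2) (u : E3) :
    ⟪((φ p : S2) : E3), sder (fun p => ((φ p : S2) : E3)) p u⟫ = 0 := by
  have h := sder_inner φ.sphereSmooth φ.sphereSmooth p u
  simp only [inner_coe_self, sder_const] at h
  rw [real_inner_comm (((φ p : S2) : E3)) (sder _ p u)] at h
  linarith

theorem SmoothSection.inner_sder {φ : SphereMap} (V : SmoothSection φ) (p : S2) (u : E3) :
    ⟪((φ p : S2) : E3), sder V.toFun p u⟫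
      = -⟪sder (fun p => ((φ p : S2) : E3)) p u, V.toFun p⟫ := by
  have h := sder_inner φ.sphereSmooth V.sphereSmooth p u
  simp only [V.tangent, sder_const] at h
  linarith

/-- The derivative of the normalization of a nonvanishing vector valued function. -/
theorem norm_sq_sder_normalize {A : S2 → E3} (hA : SphereSmooth A) (h0 : ∀ p, A p ≠ 0) (p : S2)
    (u : E3) : ‖sder (fun p => ‖A p‖⁻¹ • A p) p u‖ ^ 2
      = ‖sder A p u‖ ^ 2 * (‖A p‖ ^ 2)⁻¹ - ⟪A p, sder A p u⟫ ^ 2 * ((‖A p‖ ^ 2)⁻¹) ^ 2 := by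
  have hc : SphereSmooth fun p => ‖A p‖⁻¹ := hA.comp_contDiffAt (F := fun x => ‖x‖⁻¹) fun p =>
    (contDiffAt_norm ℝ (h0 p)).inv (norm_ne_zero_iff.2 (h0 p))
  -- Differentiating this identity yields the derivative of `‖A‖⁻¹` without differentiating the norm
  -- itself.
  have h1 : (fun p => (‖A p‖⁻¹ * ‖A p‖⁻¹) * ⟪A p, A p⟫) = fun _ => (1 : ℝ) := by
    funext p
    have := norm_ne_zero_iff.2 (h0 p)
    rw [real_inner_self_eq_norm_sq]
    field_simp
  have h2 := sder_mul (hc.mul hc) (hA.inner hA) p u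
  rw [h1, sder_const, sder_mul hc hc, sder_inner hA hA, real_inner_comm (A p) (sder A p u),
    real_inner_self_eq_norm_sq] at h2
  rw [sder_smul hc hA, norm_add_sq_real, norm_smul, norm_smul, inner_smul_left, inner_smul_right,
    real_inner_comm (A p) (sder A p u)]
  have hn := norm_ne_zero_iff.2 (h0 p)
  simp only [mul_pow, Real.norm_eq_abs, sq_abs, conj_trivial]
  generalize sder (fun p => ‖A p‖⁻¹) p u = c' at *
  generalize ⟪A p, sder A p u⟫ = b at *
  generalize ‖A p‖ = n at *
  generalize ‖sder A p u‖ = a at *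
  have h3 : c' = -(b * n⁻¹ ^ 3) := by
    field_simp at h2 ⊢
    linarith
  rw [h3]
  field_simp
  ring

/-- The function is the energy density of the normalization of `Φ + r V`, with `a = |dΦ|²`, `b =
⟨dΦ, dV⟩`, `c = |dV|²`, `e = ⟨V, dV⟩` and `v = |V|²` in a fixed direction. Derivatives for every `r`
are needed to differentiate twice under the integral. -/
theorem hasDerivAt_second_order {a b c e v : ℝ} (hv : 0 ≤ v) (r : ℝ) :
    let k : ℝ → ℝ := fun r => (1 + r ^ 2 * v)⁻¹
    HasDerivAt (fun r => (a + 2 * r * b + r ^ 2 * c) * k r - r ^ 4 * e ^ 2 * k r ^ 2)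
      ((2 * b + 2 * r * c) * k r - (a + 2 * r * b + r ^ 2 * c) * (2 * r * v) * k r ^ 2
        - 4 * r ^ 3 * e ^ 2 * k r ^ 2 + 4 * r ^ 5 * v * e ^ 2 * k r ^ 3) r ∧
    HasDerivAt (fun r => (2 * b + 2 * r * c) * k r
        - (a + 2 * r * b + r ^ 2 * c) * (2 * r * v) * k r ^ 2
        - 4 * r ^ 3 * e ^ 2 * k r ^ 2 + 4 * r ^ 5 * v * e ^ 2 * k r ^ 3)
      (2 * c * k r - (8 * b * r * v + 8 * r ^ 2 * c * v) * k r ^ 2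
        - (a + 2 * r * b + r ^ 2 * c) * (2 * v * k r ^ 2 - 8 * r ^ 2 * v ^ 2 * k r ^ 3)
        - 12 * r ^ 2 * e ^ 2 * k r ^ 2 + 36 * r ^ 4 * v * e ^ 2 * k r ^ 3
        - 24 * r ^ 6 * v ^ 2 * e ^ 2 * k r ^ 4) r := by
  intro k
  have hk0 : (1 + r ^ 2 * v) ≠ 0 := by positivity
  have hk : HasDerivAt k (-(2 * r * v) * k r ^ 2) r := by
    have h := (((hasDerivAt_pow 2 r).mul_const v).const_add 1).inv hk0
    refine h.congr_deriv ?_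
    simp only [k]
    field_simp
    simp
    ring
  have hq : HasDerivAt (fun r : ℝ => a + 2 * r * b + r ^ 2 * c) (2 * b + 2 * r * c) r := by
    have h := ((((hasDerivAt_id' r).const_mul 2).mul_const b).const_add a).add
      ((hasDerivAt_pow 2 r).mul_const c)
    refine h.congr_deriv ?_
    simp
  have hl : HasDerivAt (fun r : ℝ => 2 * b + 2 * r * c) (2 * c) r := by
    have h := ((((hasDerivAt_id' r).const_mul 2).mul_const c).const_add (2 * b))
    refine h.congr_deriv ?_
    simp
  constructor
  · have h := (hq.mul hk).sub (((hasDerivAt_pow 4 r).mul_const (e ^ 2)).mul (hk.pow 2))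
    refine h.congr_deriv ?_
    simp
    ring
  · have h := (((hl.mul hk).sub ((hq.mul (((hasDerivAt_id' r).const_mul 2).mul_const v)).mul
      (hk.pow 2))).sub ((((hasDerivAt_pow 3 r).const_mul 4).mul_const (e ^ 2)).mul (hk.pow 2))).add
      (((((hasDerivAt_pow 5 r).const_mul 4).mul_const v).mul_const (e ^ 2)).mul (hk.pow 3))
    refine h.congr_deriv ?_
    simp
    ring

/-- At `r = 0` only the `r²` coefficient `c - a v` of the density contributes; the term in `e` is of
order `r⁴`. The factor `1/2` cancels the `2` of the second derivative. -/
theorem deriv_deriv_integral {a b c e : Fin 3 → S2 → ℝ} {v : S2 → ℝ}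
    (ha : ∀ i, Continuous (a i)) (hb : ∀ i, Continuous (b i)) (hc : ∀ i, Continuous (c i))
    (he : ∀ i, Continuous (e i)) (hv : Continuous v) (hv0 : ∀ p, 0 ≤ v p) :
    deriv (deriv fun r : ℝ => (1 / 2) * ∫ p, ∑ i, ((a i p + 2 * r * b i p + r ^ 2 * c i p)
      * (1 + r ^ 2 * v p)⁻¹ - r ^ 4 * e i p ^ 2 * ((1 + r ^ 2 * v p)⁻¹) ^ 2) ∂area) 0
      = ∫ p, ∑ i, (c i p - a i p * v p) ∂area := by
  have hk : Continuous fun x : ℝ × S2 => (1 + x.1 ^ 2 * v x.2)⁻¹ :=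
    Continuous.inv₀ (by fun_prop) fun x => by have := hv0 x.2; positivity
  have hk1 : ∀ r, Continuous fun p => (1 + r ^ 2 * v p)⁻¹ := fun r =>
    hk.comp (Continuous.prodMk_right r)
  have d1 := fun r => hasDerivAt_integral_area
    (F := fun r p => ∑ i, ((a i p + 2 * r * b i p + r ^ 2 * c i p)
      * (1 + r ^ 2 * v p)⁻¹ - r ^ 4 * e i p ^ 2 * ((1 + r ^ 2 * v p)⁻¹) ^ 2))
    (fun r => by have := hk1 r; fun_prop) (by simp only [Function.uncurry_def]; fun_prop)
    (fun r p => HasDerivAt.fun_sum fun i _ =>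
      (hasDerivAt_second_order (a := a i p) (b := b i p) (c := c i p) (e := e i p) (hv0 p) r).1) r
  have d2 := hasDerivAt_integral_area
    (fun r => by have := hk1 r; fun_prop) (by simp only [Function.uncurry_def]; fun_prop)
    (fun r p => HasDerivAt.fun_sum (u := Finset.univ) fun i _ =>
      (hasDerivAt_second_order (a := a i p) (b := b i p) (c := c i p) (e := e i p) (hv0 p) r).2) 0
  have e1 := funext fun r => ((d1 r).const_mul (1 / 2)).deriv
  refine (congrArg (fun f => deriv f 0) e1).trans ?_
  rw [(d2.const_mul (1 / 2)).deriv, ← integral_const_mul]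
  congr 1
  funext p
  rw [Finset.mul_sum]
  refine Finset.sum_congr rfl fun i _ => ?_
  simp
  ring

theorem tangDeriv_eq_sder (V : S2 → E3) (p : S2) (u : E3) : tangDeriv V p u = sder V p u := rfl

theorem SmoothSection.norm_sq_add {φ : SphereMap} (V : SmoothSection φ) (r : ℝ) (p : S2) :
    ‖((φ p : S2) : E3) + r • V.toFun p‖ ^ 2 = 1 + r ^ 2 * ‖V.toFun p‖ ^ 2 := by
  rw [norm_add_sq_real, inner_smul_right, V.tangent, norm_coe, norm_smul, mul_pow,
    Real.norm_eq_abs, sq_abs]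
  ring

/-- The second variation of the energy. -/
theorem hessian_self {φ : SphereMap} (V : SmoothSection φ) :
    hessian V V = ∫ p, ∑ i, (‖sder V.toFun p (basisVec i)‖ ^ 2
      - ‖sder (fun p => ((φ p : S2) : E3)) p (basisVec i)‖ ^ 2 * ‖V.toFun p‖ ^ 2) ∂area := by
  set Φ : S2 → E3 := fun p => ((φ p : S2) : E3) with hΦ
  have sΦ : SphereSmooth Φ := φ.sphereSmooth
  have sV := V.sphereSmooth
  have key : ∀ r : ℝ, energy (variation φ (r • V.toFun)) = (1 / 2) * ∫ p, ∑ i,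
      ((‖sder Φ p (basisVec i)‖ ^ 2 + 2 * r * ⟪sder Φ p (basisVec i), sder V.toFun p (basisVec i)⟫
        + r ^ 2 * ‖sder V.toFun p (basisVec i)‖ ^ 2) * (1 + r ^ 2 * ‖V.toFun p‖ ^ 2)⁻¹
        - r ^ 4 * ⟪V.toFun p, sder V.toFun p (basisVec i)⟫ ^ 2
          * ((1 + r ^ 2 * ‖V.toFun p‖ ^ 2)⁻¹) ^ 2) ∂area := by
    intro r
    have sA : SphereSmooth fun p => Φ p + r • V.toFun p :=
      sΦ.add ((sphereSmooth_const r).smul sV)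
    have hA0 : ∀ p, Φ p + r • V.toFun p ≠ 0 := fun p h => by
      have := V.norm_sq_add r p
      rw [show ((φ p : S2) : E3) + r • V.toFun p = 0 from h] at this
      have h2 : 0 < 1 + r ^ 2 * ‖V.toFun p‖ ^ 2 := by positivity
      simp at this
      linarith
    have hvar : variation φ (r • V.toFun)
        = fun p => ‖Φ p + r • V.toFun p‖⁻¹ • (Φ p + r • V.toFun p) := by
      funext p
      exact coe_radialProj (hA0 p)
    rw [energy, hvar]
    congr 2
    funext p
    refine Finset.sum_congr rfl fun i _ => ?_
    have hd : ∀ u, sder (fun p => Φ p + r • V.toFun p) p u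
        = sder Φ p u + r • sder V.toFun p u := fun u => by
      rw [sder_add sΦ ((sphereSmooth_const r).smul sV), sder_smul (sphereSmooth_const r) sV,
        sder_const, zero_smul, add_zero]
    rw [tangDeriv_eq_sder, norm_sq_sder_normalize sA hA0, V.norm_sq_add, hd]
    congr 2
    · rw [norm_add_sq_real, inner_smul_right, norm_smul, mul_pow, Real.norm_eq_abs, sq_abs]
      ring
    -- Since `|Φ|² = 1` and `⟨Φ, V⟩ = 0`, the terms of order `1` and `r` in `⟨A, dA⟩` cancel. What
    -- is left is `r² ⟨V, dV⟩`, whose square gives `r⁴`.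
    · have h1 := inner_sder_self_eq_zero φ p (basisVec i)
      have h2 := V.inner_sder p (basisVec i)
      simp only [inner_add_left, inner_add_right, inner_smul_left, inner_smul_right,
        conj_trivial]
      rw [hΦ]
      simp only
      rw [h1, h2, real_inner_comm (V.toFun p)]
      ring
  -- For equal arguments the variation depends on `s + t` only, so the mixed derivative is an
  -- ordinary second derivative.
  have hlin : ∀ s t : ℝ, s • V.toFun + t • V.toFun = (s + t) • V.toFun := fun s t =>
    (add_smul s t _).symm
  unfold hessian
  simp only [hlin, key]
  simp only [deriv_comp_const_add (f := fun r : ℝ => (1 / 2) * ∫ p, ∑ i,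
      ((‖sder Φ p (basisVec i)‖ ^ 2 + 2 * r * ⟪sder Φ p (basisVec i), sder V.toFun p (basisVec i)⟫
        + r ^ 2 * ‖sder V.toFun p (basisVec i)‖ ^ 2) * (1 + r ^ 2 * ‖V.toFun p‖ ^ 2)⁻¹
        - r ^ 4 * ⟪V.toFun p, sder V.toFun p (basisVec i)⟫ ^ 2
          * ((1 + r ^ 2 * ‖V.toFun p‖ ^ 2)⁻¹) ^ 2) ∂area), add_zero]
  exact deriv_deriv_integral
    (fun i => (sΦ.continuous_sder continuous_const).norm.pow 2)
    (fun i => (sΦ.continuous_sder continuous_const).inner (sV.continuous_sder continuous_const))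
    (fun i => (sV.continuous_sder continuous_const).norm.pow 2)
    (fun i => sV.continuous.inner (sV.continuous_sder continuous_const))
    (sV.continuous.norm.pow 2) (fun p => by positivity)

/-! ### Cross product identities and the Bogomolny formula for holomorphic maps. -/

theorem inner_cross_self_left (a b : E3) : ⟪a, cross a b⟫ = 0 := by
  rw [inner_eq_coord]; simp [cross]; ring

theorem inner_cross_self_right (a b : E3) : ⟪a, cross b a⟫ = 0 := by
  rw [inner_eq_coord]; simp [cross]; ring

theorem cross_smul_right (c : ℝ) (a b : E3) : cross a (c • b) = c • cross a b :=
  map_smul (crossL a) c b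

theorem cross_add_right (a b c : E3) : cross a (b + c) = cross a b + cross a c :=
  map_add (crossL a) b c

theorem cross_sub_right (a b c : E3) : cross a (b - c) = cross a b - cross a c :=
  map_sub (crossL a) b c

theorem cross_neg_right (a b : E3) : cross a (-b) = -cross a b := map_neg (crossL a) b

theorem cross_neg_left (a b : E3) : cross (-a) b = -cross a b := by
  ext i; fin_cases i <;> simp [cross] <;> ring

theorem cross_self (a : E3) : cross a a = 0 := by
  ext i; fin_cases i <;> simp [cross] <;> ring

theorem cross_anticomm (a b : E3) : cross a b = -cross b a := by
  ext i; fin_cases i <;> simp [cross] <;> ring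

theorem cross_basisVec_zero (p : E3) :
    cross (basisVec 0) p = (-p 2) • basisVec 1 + p 1 • basisVec 2 := by
  ext i; fin_cases i <;> simp [cross, basisVec]

theorem cross_basisVec_one (p : E3) :
    cross (basisVec 1) p = p 2 • basisVec 0 + (-p 0) • basisVec 2 := by
  ext i; fin_cases i <;> simp [cross, basisVec]

theorem cross_basisVec_two (p : E3) :
    cross (basisVec 2) p = (-p 1) • basisVec 0 + p 0 • basisVec 1 := by
  ext i; fin_cases i <;> simp [cross, basisVec]

/-- Rotating the tangent plane at `p` by a right angle does not change the Hilbert-Schmidt norm. -/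
theorem sum_norm_sq_cross {F : Type*} [NormedAddCommGroup F] [InnerProductSpace ℝ F]
    (L : E3 →L[ℝ] F) (p : S2) (hL : L p = 0) :
    ∑ i, ‖L (cross p (basisVec i))‖ ^ 2 = ∑ i, ‖L (basisVec i)‖ ^ 2 := by
  have h1 : ∀ i, ‖L (cross p (basisVec i))‖ = ‖L (cross (basisVec i) p)‖ := fun i => by
    rw [cross_anticomm, map_neg, norm_neg]
  have hp := height_mem p
  -- The two sums differ by `|L p|²`, up to a multiple of `|p|² - 1`; it is expanded in the standard
  -- basis below.
  have h2 : ‖L (p : E3)‖ ^ 2 = 0 := by simp [hL]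
  rw [eq_sum_basisVec (p : E3)] at h2
  simp only [h1, Fin.sum_univ_three, cross_basisVec_zero, cross_basisVec_one, cross_basisVec_two,
    map_add, map_smul, ← real_inner_self_eq_norm_sq, inner_add_left, inner_add_right,
    inner_smul_left, inner_smul_right, conj_trivial] at h2 ⊢
  rw [real_inner_comm (L (basisVec 0)) (L (basisVec 1)),
    real_inner_comm (L (basisVec 0)) (L (basisVec 2)),
    real_inner_comm (L (basisVec 1)) (L (basisVec 2))] at h2 ⊢
  linear_combination (⟪L (basisVec 0), L (basisVec 0)⟫ + ⟪L (basisVec 1), L (basisVec 1)⟫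
    + ⟪L (basisVec 2), L (basisVec 2)⟫) * hp - h2

theorem two_le_infty : (1 + 1 : WithTop ℕ∞) ≤ ∞ := by
  rw [one_add_one_eq_two]
  exact WithTop.coe_le_coe.2 (le_top (a := (2 : ℕ∞)))

/-- The commutation of partial derivatives. -/
theorem sum_sder_sder_cross {f : S2 → E3} (hf : SphereSmooth f) (p : S2) :
    ∑ i, sder (fun p => sder f p (basisVec i)) p (cross (basisVec i) p) = 0 := by
  set F : E3 → E3 := fun x => f (radialProj x)
  have hF : ContDiffAt ℝ ∞ F p := hf.contDiffAt (compl_zero_mem_nhds p)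
  have hsym := hF.isSymmSndFDerivAt (by simpa [one_add_one_eq_two] using two_le_infty)
  have hd : DifferentiableAt ℝ (fderiv ℝ F) p :=
    (hF.fderiv_right (m := 1) two_le_infty).differentiableAt (by simp)
  have h1 : ∀ i, sder (fun p => sder f p (basisVec i)) p (cross (basisVec i) p)
      = fderiv ℝ (fderiv ℝ F) p (cross (basisVec i) p) (basisVec i) := fun i => by
    have h2 : HasFDerivAt (fun x => fderiv ℝ F x (basisVec i))
        ((fderiv ℝ (fderiv ℝ F) p).flip (basisVec i)) (p : E3) := by
      simpa using hd.hasFDerivAt.clm_apply (hasFDerivAt_const (basisVec i) (p : E3))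
    have h3 := sder_comp_coe h2.differentiableAt (cross (basisVec i) p)
    rw [inner_cross_self_right, zero_smul, sub_zero, h2.fderiv] at h3
    exact h3
  simp only [h1, Fin.sum_univ_three, cross_basisVec_zero, cross_basisVec_one, cross_basisVec_two,
    map_add, map_smul, _root_.add_apply, _root_.smul_apply]
  -- The matrix of `u ↦ u × p` is antisymmetric while the second derivative is symmetric, so their
  -- contraction is zero.
  rw [hsym (basisVec 1) (basisVec 0), hsym (basisVec 2) (basisVec 0),
    hsym (basisVec 2) (basisVec 1)]
  module

/-- Holomorphic maps of the sphere: the differential commutes with the complex structures. -/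
def IsHolomorphic (φ : SphereMap) : Prop := ∀ (p : S2) (u : E3),
  sder (fun p => ((φ p : S2) : E3)) p (cross p u)
    = cross (φ p : S2) (sder (fun p => ((φ p : S2) : E3)) p u)

theorem inner_cross_swap (a b c : E3) : ⟪a, cross b c⟫ = -⟪cross b a, c⟫ := by
  rw [inner_eq_coord, inner_eq_coord]; simp [cross]; ring

theorem norm_sq_cross (a b : E3) : ‖cross a b‖ ^ 2 = ‖a‖ ^ 2 * ‖b‖ ^ 2 - ⟪a, b⟫ ^ 2 := by
  rw [inner_eq_coord, norm_sq_eq_coord, norm_sq_eq_coord, norm_sq_eq_coord]; simp [cross]; ring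

theorem cross_cross_left (a b c : E3) : cross (cross a b) c = ⟪a, c⟫ • b - ⟪b, c⟫ • a := by
  rw [inner_eq_coord, inner_eq_coord]
  ext i; fin_cases i <;> simp [cross] <;> ring

/-- This is Parseval in the plane orthogonal to `q`: `m` and `q × m` are orthogonal there and have
equal length. Algebraically, `m × v` is parallel to `q`, so its norm is its component along `q`. -/
theorem inner_sq_add_inner_cross_sq {q m v : E3} (hq : ‖q‖ = 1) (hm : ⟪q, m⟫ = 0)
    (hv : ⟪q, v⟫ = 0) : ⟪m, v⟫ ^ 2 + ⟪cross q m, v⟫ ^ 2 = ‖m‖ ^ 2 * ‖v‖ ^ 2 := by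
  have h1 : cross (cross m v) q = 0 := by
    rw [cross_cross_left, real_inner_comm, real_inner_comm q v, hm, hv, zero_smul, zero_smul,
      sub_zero]
  have h2 := norm_sq_cross (cross m v) q
  have h3 : ⟪cross m v, q⟫ = ⟪cross q m, v⟫ := by
    rw [inner_eq_coord, inner_eq_coord]; simp [cross]; ring
  rw [h1, norm_sq_cross, hq, h3] at h2
  simp at h2
  linarith

theorem cross_cross_of_tangent {q m v : E3} (hv : ⟪q, v⟫ = 0) :
    cross (cross q m) v = (-⟪m, v⟫) • q := by
  rw [cross_cross_left, hv, zero_smul, zero_sub, neg_smul]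

theorem covDeriv_eq (φ : SphereMap) (V : S2 → E3) (p : S2) (u : E3) :
    covDeriv φ V p u = sder V p u - ⟪((φ p : S2) : E3), sder V p u⟫ • ((φ p : S2) : E3) := rfl

/-- Here `m = dφ(u)`, `a = dV(u)`, `b = dV(Ju)`, with `q × m = dφ(Ju)` by holomorphy. Completing the
square leaves three remainders: the second line becomes a divergence, and each difference in the
third vanishes after summation over `u`, because rotating the tangent plane preserves
Hilbert-Schmidt norms. -/
theorem bogomolny_summand {q a b m v : E3} (hq : ‖q‖ = 1) (hm : ⟪q, m⟫ = 0) (hv : ⟪q, v⟫ = 0)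
    (ha : ⟪q, a⟫ = -⟪m, v⟫) (hb : ⟪q, b⟫ = -⟪cross q m, v⟫) :
    ‖a‖ ^ 2 - ‖m‖ ^ 2 * ‖v‖ ^ 2 = 1 / 2 * ‖b - ⟪q, b⟫ • q - cross q (a - ⟪q, a⟫ • q)‖ ^ 2
      + (-⟪cross (cross q m) v, a⟫ - ⟪cross q b, a⟫)
      + 1 / 2 * (‖a‖ ^ 2 - ‖b‖ ^ 2) + 1 / 2 * (⟪m, v⟫ ^ 2 - ⟪cross q m, v⟫ ^ 2) := by
  rw [cross_cross_of_tangent hv, cross_sub_right, cross_smul_right, cross_self, smul_zero,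
    sub_zero, inner_smul_left, ← inner_sq_add_inner_cross_sq hq hm hv, norm_sub_sq_real,
    norm_sub_sq_real, norm_sq_cross, norm_smul, mul_pow, inner_smul_right, inner_sub_left,
    inner_smul_left, inner_cross_self_left, inner_cross_swap, real_inner_comm q b, ha, hb, hq]
  simp
  ring

/-- For a holomorphic map the second variation of the energy is the squared norm of
`𝔇^φ V`. -/
theorem hessian_self_of_isHolomorphic {φ : SphereMap} (hφ : IsHolomorphic φ)
    (V : SmoothSection φ) :
    hessian V V = 1 / 2 * ∫ p, ∑ i, ‖covDeriv φ V.toFun p (cross p (basisVec i))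
      - cross (φ p : S2) (covDeriv φ V.toFun p (basisVec i))‖ ^ 2 ∂area := by
  set Φ : S2 → E3 := fun p => ((φ p : S2) : E3) with hΦ
  have sΦ : SphereSmooth Φ := φ.sphereSmooth
  have sV := V.sphereSmooth
  have sA := fun i => (sΦ.cross sV).inner (sV.sder (basisVec i))
  have hst : ∀ i, ∫ p, sder (fun p => ⟪cross (Φ p) (V.toFun p), sder V.toFun p (basisVec i)⟫) p
      (cross (basisVec i) p) ∂area = 0 := fun i =>
    integral_sder_cross (norm_basisVec i) (sA i)
  have hint := fun i => integrable_of_continuous ((sA i).continuous_sder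
    (Y := fun p => cross (basisVec i) p) ((crossL (basisVec i)).continuous.comp
      continuous_subtype_val))
  have hS := integral_finsetSum Finset.univ fun i _ => hint i
  simp only [hst, Finset.sum_const_zero] at hS
  have hcov : ∀ {Y : S2 → E3}, Continuous Y →
      Continuous fun p => covDeriv φ V.toFun p (Y p) := by
    intro Y hY
    have h1 := sV.continuous_sder hY
    have h2 : Continuous fun p => ⟪Φ p, sder V.toFun p (Y p)⟫ := sΦ.continuous.inner h1
    exact h1.sub (h2.smul sΦ.continuous)
  have hcr : ∀ i, Continuous fun p : S2 => cross p (basisVec i) := fun i =>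
    (sphereSmooth_coe.cross (sphereSmooth_const (basisVec i))).continuous
  have hB : Continuous fun p => ∑ i, ‖covDeriv φ V.toFun p (cross p (basisVec i))
      - cross (φ p : S2) (covDeriv φ V.toFun p (basisVec i))‖ ^ 2 :=
    continuous_finsetSum _ fun i _ => (((hcov (hcr i)).sub
      ((crossL.continuous.comp sΦ.continuous).clm_apply (hcov continuous_const))).norm.pow 2)
  rw [hessian_self, ← integral_const_mul, ← add_zero (∫ p, 1 / 2 * _ ∂area), ← hS, ← integral_add
    ((integrable_of_continuous hB).const_mul _) (integrable_finsetSum _ fun i _ => hint i)]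
  congr 1
  funext p
  have hp0 : sder V.toFun p (p : E3) = 0 := sder_self sV p
  have hp1 : sder Φ p (p : E3) = 0 := sder_self sΦ p
  have hab := sum_norm_sq_cross (fderiv ℝ (fun x => V.toFun (radialProj x)) (p : E3)) p hp0
  have hmb := sum_norm_sq_cross ((innerSL ℝ (V.toFun p)).comp
    (fderiv ℝ (fun x => Φ (radialProj x)) (p : E3))) p (by
      simp only [ContinuousLinearMap.comp_apply]
      rw [show fderiv ℝ (fun x => Φ (radialProj x)) (p : E3) p = 0 from hp1, map_zero])
  have hcomm := congrArg (fun v => ⟪cross (Φ p) (V.toFun p), v⟫) (sum_sder_sder_cross sV p)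
  simp only [inner_sum, inner_zero_right] at hcomm
  -- The middle remainder is the derivative of `⟨Φ × V, dV(e_i)⟩` along the rotation field `e_i ×
  -- p`, minus a second-order term. The former integrates to zero, the latter sums to zero by
  -- `hcomm`.
  have hsum : ∀ i, ‖sder V.toFun p (basisVec i)‖ ^ 2
        - ‖sder Φ p (basisVec i)‖ ^ 2 * ‖V.toFun p‖ ^ 2
      = 1 / 2 * ‖covDeriv φ V.toFun p (cross p (basisVec i))
          - cross (φ p : S2) (covDeriv φ V.toFun p (basisVec i))‖ ^ 2
        + (sder (fun p => ⟪cross (Φ p) (V.toFun p), sder V.toFun p (basisVec i)⟫) p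
            (cross (basisVec i) p) - ⟪cross (Φ p) (V.toFun p),
            sder (fun p => sder V.toFun p (basisVec i)) p (cross (basisVec i) p)⟫)
        + 1 / 2 * (‖sder V.toFun p (basisVec i)‖ ^ 2
          - ‖sder V.toFun p (cross p (basisVec i))‖ ^ 2)
        + 1 / 2 * (⟪V.toFun p, sder Φ p (basisVec i)⟫ ^ 2
          - ⟪V.toFun p, sder Φ p (cross p (basisVec i))⟫ ^ 2) := by
    intro i
    have hh := hφ p (basisVec i)
    have hb := V.inner_sder p (cross p (basisVec i))
    rw [hh] at hb
    rw [bogomolny_summand (norm_coe (φ p)) (inner_sder_self_eq_zero φ p (basisVec i))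
      (V.tangent p) (V.inner_sder p (basisVec i)) hb, covDeriv_eq, covDeriv_eq,
      sder_inner (sΦ.cross sV) (sV.sder _), sder_cross sΦ sV, cross_anticomm (basisVec i),
      sder_neg_dir, sder_neg_dir, hh]
    have h1 : sder Φ p (-cross p (basisVec i)) = -cross (Φ p) (sder Φ p (basisVec i)) := by
      rw [sder_neg_dir]
      exact congrArg Neg.neg hh
    rw [h1, cross_neg_right, cross_neg_left, inner_add_left, inner_neg_left, inner_neg_left,
      real_inner_comm (V.toFun p), real_inner_comm (V.toFun p)]
    ring
  rw [Finset.sum_congr rfl fun i _ => hsum i]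
  simp only [Finset.sum_add_distrib, Finset.sum_sub_distrib, ← Finset.mul_sum]
  have hab' : ∑ i, ‖sder V.toFun p (cross p (basisVec i))‖ ^ 2
      = ∑ i, ‖sder V.toFun p (basisVec i)‖ ^ 2 := hab
  have hmb' : ∑ i, ⟪V.toFun p, sder Φ p (cross p (basisVec i))⟫ ^ 2
      = ∑ i, ⟪V.toFun p, sder Φ p (basisVec i)⟫ ^ 2 := by
    simp only [ContinuousLinearMap.comp_apply, innerSL_apply_apply, Real.norm_eq_abs, sq_abs] at hmb
    exact hmb
  rw [hcomm, hab', hmb']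
  ring

/-! ### The maps `φ_μ`: holomorphy, conformal factor and Hessian. -/

/-- The denominator of `lumpFun`, as a function of the height. -/
def lumpDenom (μ s : ℝ) : ℝ := (1 - s) + μ ^ 2 * (1 + s)

theorem height_mem_Icc (p : S2) : (p : E3) 2 ∈ Set.Icc (-1 : ℝ) 1 := by
  have h := height_mem p
  constructor <;> nlinarith [sq_nonneg ((p : E3) 0), sq_nonneg ((p : E3) 1)]

theorem lumpDenom_pos {μ s : ℝ} (hμ : 0 < μ) (hs : s ∈ Set.Icc (-1 : ℝ) 1) :
    0 < lumpDenom μ s := by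
  unfold lumpDenom
  have h3 : 0 < μ ^ 2 := by positivity
  rcases eq_or_lt_of_le hs.2 with h4 | h4
  · rw [h4]; linarith
  · nlinarith [mul_nonneg h3.le (by linarith [hs.1] : 0 ≤ 1 + s)]

theorem coe_lump (μ : Set.Ioi (0 : ℝ)) (p : S2) : ((lump μ p : S2) : E3) = lumpFun μ p := rfl

section

variable (μ : Set.Ioi (0 : ℝ)) (p : S2)

theorem lump_zero : ((lump μ p : S2) : E3) 0 = 2 * μ * (p : E3) 0 / lumpDenom μ ((p : E3) 2) := by
  rw [coe_lump]; simp [lumpFun, lumpDenom]; ring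

theorem lump_one : ((lump μ p : S2) : E3) 1 = 2 * μ * (p : E3) 1 / lumpDenom μ ((p : E3) 2) := by
  rw [coe_lump]; simp [lumpFun, lumpDenom]; ring

theorem lump_two : ((lump μ p : S2) : E3) 2
    = ((μ : ℝ) ^ 2 - 1 + ((μ : ℝ) ^ 2 + 1) * (p : E3) 2) / lumpDenom μ ((p : E3) 2) := by
  rw [coe_lump]; simp [lumpFun, lumpDenom]; ring

theorem lumpDenom_ne : lumpDenom μ ((p : E3) 2) ≠ 0 :=
  (lumpDenom_pos μ.2 (height_mem_Icc p)).ne'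

theorem sder_apply {f : S2 → E3} (hf : SphereSmooth f) (p : S2) (u : E3) (i : Fin 3) :
    sder (fun p => f p i) p u = sder f p u i := by
  have h := sder_comp hf (F := fun x : E3 => x i) p
    (EuclideanSpace.proj i : E3 →L[ℝ] ℝ).differentiableAt u
  rw [show fderiv ℝ (fun x : E3 => x i) (f p) = (EuclideanSpace.proj i : E3 →L[ℝ] ℝ) from
    (EuclideanSpace.proj i : E3 →L[ℝ] ℝ).fderiv] at h
  exact h

theorem sphereSmooth_affine (a b : ℝ) (i : Fin 3) :
    SphereSmooth fun p : S2 => a + b * (p : E3) i :=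
  (sphereSmooth_const a).add ((sphereSmooth_const b).mul (sphereSmooth_coord i))

theorem sder_affine (a b : ℝ) (i : Fin 3) (u : E3) (hu : ⟪(p : E3), u⟫ = 0) :
    sder (fun p : S2 => a + b * (p : E3) i) p u = b * u i := by
  rw [sder_add (sphereSmooth_const a) ((sphereSmooth_const b).mul (sphereSmooth_coord i)),
    sder_mul (sphereSmooth_const b) (sphereSmooth_coord i), sder_const, sder_const, sder_coord, hu]
  ring

theorem lumpDenom_eq_affine (μ s : ℝ) : lumpDenom μ s = (1 + μ ^ 2) + (μ ^ 2 - 1) * s := by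
  unfold lumpDenom; ring

/-- A coordinate of `lump μ` is a quotient of affine functions. -/
theorem sder_lump_coord {i : Fin 3} {a b : ℝ}
    (h : ∀ p : S2, ((lump μ p : S2) : E3) i = (a + b * (p : E3) i) / lumpDenom μ ((p : E3) 2))
    {u : E3} (hu : ⟪(p : E3), u⟫ = 0) :
    sder (fun p => ((lump μ p : S2) : E3)) p u i = (b * u i
      - ((μ : ℝ) ^ 2 - 1) * u 2 * ((lump μ p : S2) : E3) i) / lumpDenom μ ((p : E3) 2) := by
  -- Clearing the denominator allows the product rule to replace the quotient rule.
  have h1 : (fun p : S2 => ((1 + (μ : ℝ) ^ 2) + ((μ : ℝ) ^ 2 - 1) * (p : E3) 2)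
      * ((lump μ p : S2) : E3) i) = fun p : S2 => a + b * (p : E3) i := by
    funext p
    rw [h p, ← lumpDenom_eq_affine, mul_div_cancel₀ _ (lumpDenom_ne μ p)]
  have sΦ := (lump μ).sphereSmooth
  have sΦi : SphereSmooth fun p => ((lump μ p : S2) : E3) i :=
    sΦ.comp_contDiffAt (F := fun x => x i) fun _ => (contDiff_coord i).contDiffAt
  have h2 := sder_mul (sphereSmooth_affine (1 + (μ : ℝ) ^ 2) ((μ : ℝ) ^ 2 - 1) 2) sΦi p u
  rw [h1, sder_affine p _ _ _ _ hu, sder_affine p _ _ _ _ hu, sder_apply sΦ,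
    ← lumpDenom_eq_affine] at h2
  rw [eq_div_iff (lumpDenom_ne μ p)]
  linear_combination -h2

variable {p} in
theorem sder_lump_zero {u : E3} (hu : ⟪(p : E3), u⟫ = 0) :
    sder (fun p => ((lump μ p : S2) : E3)) p u 0 = (2 * μ * u 0
      - ((μ : ℝ) ^ 2 - 1) * u 2 * ((lump μ p : S2) : E3) 0) / lumpDenom μ ((p : E3) 2) :=
  sder_lump_coord μ p (a := 0) (fun p => by rw [lump_zero]; ring) hu

variable {p} in
theorem sder_lump_one {u : E3} (hu : ⟪(p : E3), u⟫ = 0) :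
    sder (fun p => ((lump μ p : S2) : E3)) p u 1 = (2 * μ * u 1
      - ((μ : ℝ) ^ 2 - 1) * u 2 * ((lump μ p : S2) : E3) 1) / lumpDenom μ ((p : E3) 2) :=
  sder_lump_coord μ p (a := 0) (fun p => by rw [lump_one]; ring) hu

variable {p} in
theorem sder_lump_two {u : E3} (hu : ⟪(p : E3), u⟫ = 0) :
    sder (fun p => ((lump μ p : S2) : E3)) p u 2 = (((μ : ℝ) ^ 2 + 1) * u 2
      - ((μ : ℝ) ^ 2 - 1) * u 2 * ((lump μ p : S2) : E3) 2) / lumpDenom μ ((p : E3) 2) :=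
  sder_lump_coord μ p (a := (μ : ℝ) ^ 2 - 1) (fun p => by rw [lump_two]) hu

theorem inner_tangential (u : E3) : ⟪(p : E3), u - ⟪(p : E3), u⟫ • (p : E3)⟫ = 0 := by
  rw [inner_sub_right, inner_smul_right, inner_coe_self, mul_one, sub_self]

theorem isHolomorphic_of_tangent {φ : SphereMap}
    (h : ∀ (p : S2) (u : E3), ⟪(p : E3), u⟫ = 0 → sder (fun p => ((φ p : S2) : E3)) p (cross p u)
      = cross (φ p : S2) (sder (fun p => ((φ p : S2) : E3)) p u)) : IsHolomorphic φ := by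
  intro p u
  have h1 := h p _ (inner_tangential p u)
  rwa [cross_sub_right, cross_smul_right, cross_self, smul_zero, sub_zero,
    ← sder_congr_tangent φ.sphereSmooth] at h1

theorem isHolomorphic_lump : IsHolomorphic (lump μ) := by
  refine isHolomorphic_of_tangent fun p u hu => ?_
  have hc : ⟪(p : E3), cross p u⟫ = 0 := inner_cross_self_left _ _
  have hp := height_mem p
  have hd := lumpDenom_ne μ p
  have hu' := hu
  rw [inner_eq_coord] at hu'
  ext i
  fin_cases i
  · simp only [Fin.zero_eta]
    rw [sder_lump_zero μ hc]
    simp only [cross]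
    simp
    rw [sder_lump_one μ hu, sder_lump_two μ hu, lump_zero, lump_one, lump_two]
    field_simp
    rw [lumpDenom_eq_affine]
    linear_combination (μ : ℝ) * ((1 + (μ : ℝ) ^ 2 + ((μ : ℝ) ^ 2 - 1) * (p : E3) 2)
      * ((μ : ℝ) ^ 2 - 1))
      * ((p : E3) 1 * hu' - u 1 * hp)
  · simp only [Fin.mk_one]
    rw [sder_lump_one μ hc]
    simp only [cross]
    simp
    rw [sder_lump_zero μ hu, sder_lump_two μ hu, lump_zero, lump_one, lump_two]
    field_simp
    rw [lumpDenom_eq_affine]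
    linear_combination (μ : ℝ) * ((1 + (μ : ℝ) ^ 2 + ((μ : ℝ) ^ 2 - 1) * (p : E3) 2)
      * ((μ : ℝ) ^ 2 - 1))
      * (u 0 * hp - (p : E3) 0 * hu')
  · simp only [Fin.reduceFinMk]
    rw [sder_lump_two μ hc]
    simp only [cross]
    simp
    rw [sder_lump_zero μ hu, sder_lump_one μ hu, lump_zero, lump_one, lump_two]
    field_simp
    rw [lumpDenom_eq_affine]
    ring

/-- The conformal factor of `lump μ`. -/
def lumpDensity (μ s : ℝ) : ℝ := 4 * μ ^ 2 / lumpDenom μ s ^ 2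

variable {p} in
theorem norm_sq_sder_lump {u : E3} (hu : ⟪(p : E3), u⟫ = 0) :
    ‖sder (fun p => ((lump μ p : S2) : E3)) p u‖ ^ 2
      = lumpDensity μ ((p : E3) 2) * ‖u‖ ^ 2 := by
  have hp := height_mem p
  have hd := lumpDenom_ne μ p
  have hu' := hu
  rw [inner_eq_coord] at hu'
  rw [norm_sq_eq_coord, norm_sq_eq_coord, sder_lump_zero μ hu, sder_lump_one μ hu,
    sder_lump_two μ hu, lump_zero, lump_one, lump_two, lumpDensity]
  field_simp
  rw [lumpDenom_eq_affine]
  linear_combination 4 * (μ : ℝ) ^ 2 * ((-2 * (1 + (μ : ℝ) ^ 2 + ((μ : ℝ) ^ 2 - 1) * (p : E3) 2)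
    * ((μ : ℝ) ^ 2 - 1) * u 2) * hu' + (((μ : ℝ) ^ 2 - 1) ^ 2 * u 2 ^ 2) * hp)

theorem inner_basisVec (i : Fin 3) (v : E3) : ⟪basisVec i, v⟫ = v i := by
  rw [inner_eq_coord]; fin_cases i <;> simp [basisVec]

theorem sum_norm_sq_sder_lump : ∑ i, ‖sder (fun p => ((lump μ p : S2) : E3)) p (basisVec i)‖ ^ 2
    = 2 * lumpDensity μ ((p : E3) 2) := by
  have hp := height_mem p
  have h : ∀ i, ‖sder (fun p => ((lump μ p : S2) : E3)) p (basisVec i)‖ ^ 2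
      = lumpDensity μ ((p : E3) 2) * (1 - (p : E3) i ^ 2) := fun i => by
    rw [sder_congr_tangent (lump μ).sphereSmooth, norm_sq_sder_lump μ (inner_tangential p _)]
    congr 1
    rw [norm_sub_sq_real, norm_basisVec, norm_smul, norm_coe, inner_smul_right, mul_pow,
      real_inner_comm, Real.norm_eq_abs, sq_abs,
      inner_basisVec]
    ring
  simp only [h, Fin.sum_univ_three]
  linear_combination (-lumpDensity μ ((p : E3) 2)) * hp

-- Holomorphy makes the sum with `dφ` replaced by `J dφ` equal to this one, and by
-- `inner_sq_add_inner_cross_sq` the two together give `|dφ|² |V|² = 2 w |V|²`.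
variable {μ p} in
theorem sum_inner_sq_sder_lump (V : SmoothSection (lump μ)) :
    ∑ i, ⟪sder (fun p => ((lump μ p : S2) : E3)) p (basisVec i), V.toFun p⟫ ^ 2
      = lumpDensity μ ((p : E3) 2) * ‖V.toFun p‖ ^ 2 := by
  have h1 := sum_norm_sq_cross ((innerSL ℝ (V.toFun p)).comp
    (fderiv ℝ (fun x => ((lump μ (radialProj x) : S2) : E3)) (p : E3))) p (by
      have hp1 := sder_self (lump μ).sphereSmooth p
      simp only [ContinuousLinearMap.comp_apply]
      rw [show fderiv ℝ (fun x => ((lump μ (radialProj x) : S2) : E3)) (p : E3) p = 0 from hp1,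
        map_zero])
  simp only [ContinuousLinearMap.comp_apply, innerSL_apply_apply, Real.norm_eq_abs, sq_abs] at h1
  have h2 : ∑ i, ⟪V.toFun p, sder (fun p => ((lump μ p : S2) : E3)) p (cross p (basisVec i))⟫ ^ 2
    = ∑ i, ⟪V.toFun p, sder (fun p => ((lump μ p : S2) : E3)) p (basisVec i)⟫ ^ 2 := h1
  have h3 := sum_norm_sq_sder_lump μ p
  have h4 := fun i => inner_sq_add_inner_cross_sq (norm_coe (lump μ p))
    (inner_sder_self_eq_zero (lump μ) p (basisVec i)) (V.tangent p)
  have h5 := Finset.sum_congr rfl fun i (_ : i ∈ Finset.univ) => h4 i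
  rw [Finset.sum_add_distrib, ← Finset.sum_mul, h3] at h5
  have h6 : ∑ i, ⟪cross (lump μ p : S2) (sder (fun p => ((lump μ p : S2) : E3)) p (basisVec i)),
      V.toFun p⟫ ^ 2 = ∑ i, ⟪sder (fun p => ((lump μ p : S2) : E3)) p (basisVec i),
      V.toFun p⟫ ^ 2 := by
    refine (Finset.sum_congr rfl fun i _ => ?_).trans
      (h2.trans (Finset.sum_congr rfl fun i _ => ?_))
    · rw [real_inner_comm, isHolomorphic_lump μ p]
    · rw [real_inner_comm]
  linarith

-- The component of `dV` normal to the target contributes `w |V|²`, which cancels half of the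
-- curvature term `|dφ|² |V|² = 2 w |V|²`. The result involves only `V` and `∇V` and is continuous
-- in the `H¹` norm.
variable {μ} in
theorem hessian_lump (V : SmoothSection (lump μ)) :
    hessian V V = (∫ p, ∑ i, ‖covDeriv (lump μ) V.toFun p (basisVec i)‖ ^ 2 ∂area)
      - ∫ p, lumpDensity μ ((p : E3) 2) * ‖V.toFun p‖ ^ 2 ∂area := by
  have sV := V.sphereSmooth
  have sΦ := (lump μ).sphereSmooth
  have hcov : ∀ i, Continuous fun p => covDeriv (lump μ) V.toFun p (basisVec i) := fun i => by
    have h1 := sV.continuous_sder (Y := fun _ => basisVec i) continuous_const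
    have h2 := sΦ.continuous.inner (𝕜 := ℝ) h1
    exact h1.sub (h2.smul sΦ.continuous)
  have hw : Continuous fun p : S2 => lumpDensity μ ((p : E3) 2) :=
    Continuous.div (by fun_prop) (by unfold lumpDenom; fun_prop)
      fun p => pow_ne_zero 2 (lumpDenom_ne μ p)
  have hV := sV.continuous
  have c1 : Continuous fun p => ∑ i, ‖covDeriv (lump μ) V.toFun p (basisVec i)‖ ^ 2 := by fun_prop
  have c2 : Continuous fun p : S2 => lumpDensity μ ((p : E3) 2) * ‖V.toFun p‖ ^ 2 := by fun_prop
  rw [hessian_self, ← integral_sub (integrable_of_continuous c1) (integrable_of_continuous c2)]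
  congr 1
  funext p
  have h1 : ∀ i, ‖sder V.toFun p (basisVec i)‖ ^ 2
      = ‖covDeriv (lump μ) V.toFun p (basisVec i)‖ ^ 2
        + ⟪sder (fun p => ((lump μ p : S2) : E3)) p (basisVec i), V.toFun p⟫ ^ 2 := fun i => by
    rw [covDeriv_eq, norm_sub_sq_real, norm_smul, norm_coe, inner_smul_right, mul_one,
      real_inner_comm _ (sder V.toFun p (basisVec i)), V.inner_sder p (basisVec i),
      Real.norm_eq_abs, sq_abs]
    ring
  rw [Finset.sum_sub_distrib, ← Finset.sum_mul, sum_norm_sq_sder_lump,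
    Finset.sum_congr rfl fun i _ => h1 i, Finset.sum_add_distrib, sum_inner_sq_sder_lump]
  ring

end

/-! ### Extension of the Hessian to `H¹` and its nonnegativity. -/

theorem inner_continuousMap_toLp {E : Type*} [NormedAddCommGroup E] [InnerProductSpace ℝ E]
    [SecondCountableTopologyEither S2 E] (f g : C(S2, E)) :
    ⟪ContinuousMap.toLp 2 area ℝ f, ContinuousMap.toLp 2 area ℝ g⟫ = ∫ p, ⟪f p, g p⟫ ∂area := by
  rw [L2.inner_def]
  refine integral_congr_ae ?_
  filter_upwards [ContinuousMap.coeFn_toLp (p := 2) area (𝕜 := ℝ) f,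
    ContinuousMap.coeFn_toLp (p := 2) area (𝕜 := ℝ) g] with p h1 h2
  rw [h1, h2]

theorem SmoothSection.inner_toL2 {φ : SphereMap} (V K : SmoothSection φ) :
    ⟪V.toL2, K.toL2⟫ = ∫ p, ⟪V.toFun p, K.toFun p⟫ ∂area := inner_continuousMap_toLp _ _

theorem SmoothSection.norm_sq_gradToL2 {φ : SphereMap} (V : SmoothSection φ) :
    ‖V.gradToL2‖ ^ 2 = ∫ p, ∑ i, ‖covDeriv φ V.toFun p (basisVec i)‖ ^ 2 ∂area := by
  rw [← real_inner_self_eq_norm_sq, SmoothSection.gradToL2, inner_continuousMap_toLp]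
  congr 1
  funext p
  rw [real_inner_self_eq_norm_sq]
  exact PiLp.norm_sq_eq_of_L2 _ _

section

variable (μ : Set.Ioi (0 : ℝ))

theorem continuous_lumpDensity : Continuous fun p : S2 => lumpDensity μ ((p : E3) 2) :=
  Continuous.div (by fun_prop) (by unfold lumpDenom; fun_prop)
    fun p => pow_ne_zero 2 (lumpDenom_ne μ p)

/-- Multiplication by the conformal factor of `lump μ`. -/
def mulDensity : L2Vec →L[ℝ] L2Vec :=
  (ContinuousLinearMap.lsmul ℝ ℝ : ℝ →L[ℝ] E3 →L[ℝ] E3).holderL area ⊤ 2 2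
    (ContinuousMap.toLp ⊤ area ℝ ⟨_, continuous_lumpDensity μ⟩)

/-- The second variation of the energy at `lump μ`, on all of `L² × L²`. -/
def hessianForm (x : L2Vec × L2Grad) : ℝ := ‖x.2‖ ^ 2 - ⟪x.1, mulDensity μ x.1⟫

theorem continuous_hessianForm : Continuous (hessianForm μ) :=
  (continuous_snd.norm.pow 2).sub
    (continuous_fst.inner ((mulDensity μ).continuous.comp continuous_fst))

variable {μ}

theorem inner_mulDensity (V : SmoothSection (lump μ)) :
    ⟪V.toL2, mulDensity μ V.toL2⟫
      = ∫ p, lumpDensity μ ((p : E3) 2) * ‖V.toFun p‖ ^ 2 ∂area := by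
  rw [L2.inner_def]
  refine integral_congr_ae ?_
  filter_upwards [ContinuousMap.coeFn_toLp (p := 2) area (𝕜 := ℝ) ⟨V.toFun, V.smooth.continuous⟩,
    ContinuousMap.coeFn_toLp (p := ⊤) area (𝕜 := ℝ)
      ⟨fun p : S2 => lumpDensity μ ((p : E3) 2), continuous_lumpDensity μ⟩,
    (ContinuousLinearMap.lsmul ℝ ℝ : ℝ →L[ℝ] E3 →L[ℝ] E3).coeFn_holder (r := 2)
      (ContinuousMap.toLp ⊤ area ℝ ⟨_, continuous_lumpDensity μ⟩) V.toL2] with p h1 h2 h3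
  have h4 : (V.toL2 : S2 → E3) p = V.toFun p := h1
  have h5 : (mulDensity μ V.toL2 : S2 → E3) p
      = lumpDensity μ ((p : E3) 2) • V.toFun p := by
    refine h3.trans ?_
    rw [h2, h4]
    rfl
  rw [h4, h5, inner_smul_right, real_inner_self_eq_norm_sq]

theorem hessian_eq_hessianForm (V : SmoothSection (lump μ)) :
    hessian V V = hessianForm μ V.jet := by
  rw [hessian_lump, hessianForm, SmoothSection.jet, V.norm_sq_gradToL2, inner_mulDensity]

theorem hessianH1_lump {x : L2Vec × L2Grad} (hx : x ∈ H1 (lump μ)) :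
    hessianH1 (lump μ) x = hessianForm μ x := by
  -- The limit defining `hessianH1` is taken along a nontrivial filter because smooth jets are dense
  -- in `H1`; this is what makes its value unique.
  have hne : (comap (SmoothSection.jet (φ := lump μ)) (𝓝 x)).NeBot := by
    rw [comap_neBot_iff]
    intro t ht
    obtain ⟨_, hy, V, rfl⟩ := mem_closure_iff_nhds.1 hx t ht
    exact ⟨V, hy⟩
  refine Tendsto.limUnder_eq ?_
  simp only [hessian_eq_hessianForm]
  exact ((continuous_hessianForm μ).tendsto x).comp tendsto_comap

theorem SmoothSection.jet_mem_H1 {φ : SphereMap} (V : SmoothSection φ) : V.jet ∈ H1 φ :=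
  subset_closure ⟨V, rfl⟩

theorem hessianH1_jet (V : SmoothSection (lump μ)) :
    hessianH1 (lump μ) V.jet = hessian V V := by
  rw [hessianH1_lump V.jet_mem_H1, hessian_eq_hessianForm]

theorem hessian_self_nonneg (V : SmoothSection (lump μ)) : 0 ≤ hessian V V := by
  rw [hessian_self_of_isHolomorphic (isHolomorphic_lump μ)]
  have : 0 ≤ ∫ p, ∑ i, ‖covDeriv (lump μ) V.toFun p (cross p (basisVec i))
      - cross (lump μ p : S2) (covDeriv (lump μ) V.toFun p (basisVec i))‖ ^ 2 ∂area :=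
    integral_nonneg fun p => Finset.sum_nonneg fun i _ => by positivity
  positivity

theorem hessianH1_nonneg {x : L2Vec × L2Grad} (hx : x ∈ H1 (lump μ)) :
    0 ≤ hessianH1 (lump μ) x := by
  rw [hessianH1_lump hx]
  refine closure_minimal ?_ (isClosed_le continuous_const (continuous_hessianForm μ)) hx
  rintro _ ⟨V, rfl⟩
  exact (hessian_self_nonneg V).trans_eq (hessian_eq_hessianForm V)

/-- The Dirichlet energy of a section dominates its weighted mass. -/
theorem integral_density_le_h1NormSq (V : SmoothSection (lump μ)) :
    ∫ p, lumpDensity μ ((p : E3) 2) * ‖V.toFun p‖ ^ 2 ∂area ≤ h1NormSq V.jet := by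
  have h := hessian_self_nonneg V
  rw [hessian_lump, ← V.norm_sq_gradToL2] at h
  have h2 : 0 ≤ ‖V.toL2‖ ^ 2 := by positivity
  simp only [h1NormSq, SmoothSection.jet]
  linarith

theorem h1NormSq_nonneg (x : L2Vec × L2Grad) : 0 ≤ h1NormSq x := by
  unfold h1NormSq; positivity

theorem h1NormSq_pos {x : L2Vec × L2Grad} (hx : x ≠ 0) : 0 < h1NormSq x := by
  refine lt_of_le_of_ne (h1NormSq_nonneg x) fun h => hx ?_
  have h1 : ‖x.1‖ ^ 2 = 0 := by unfold h1NormSq at h; nlinarith [sq_nonneg ‖x.1‖, sq_nonneg ‖x.2‖]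
  have h2 : ‖x.2‖ ^ 2 = 0 := by unfold h1NormSq at h; nlinarith [sq_nonneg ‖x.1‖, sq_nonneg ‖x.2‖]
  exact Prod.ext (norm_eq_zero.1 (pow_eq_zero_iff two_ne_zero |>.1 h1))
    (norm_eq_zero.1 (pow_eq_zero_iff two_ne_zero |>.1 h2))

theorem tau_lump_nonneg : 0 ≤ tau (lump μ) := by
  refine le_iInf₂ fun x hx => ?_
  exact_mod_cast div_nonneg (hessianH1_nonneg hx.1.1) (h1NormSq_nonneg x)

end

/-! ### Multiples of holomorphic sections, and a conformal field on the target. -/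

/-- The product of a smooth section with a smooth function. -/
def SmoothSection.mulFun {φ : SphereMap} (Y : SmoothSection φ) {c : S2 → ℝ}
    (hc : SphereSmooth c) : SmoothSection φ where
  toFun p := c p • Y.toFun p
  smooth := (hc.smul Y.sphereSmooth).contMDiff
  tangent p := by rw [inner_smul_right, Y.tangent, mul_zero]

theorem covDeriv_mulFun {φ : SphereMap} (Y : SmoothSection φ) {c : S2 → ℝ} (hc : SphereSmooth c)
    (p : S2) (u : E3) : covDeriv φ (Y.mulFun hc).toFun p u
      = sder c p u • Y.toFun p + c p • covDeriv φ Y.toFun p u := by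
  have h : sder (Y.mulFun hc).toFun p u = c p • sder Y.toFun p u + sder c p u • Y.toFun p :=
    sder_smul hc Y.sphereSmooth p u
  rw [covDeriv_eq, covDeriv_eq, h, inner_add_right, inner_smul_right, inner_smul_right, Y.tangent]
  module

theorem inner_covDeriv_of_tangent {φ : SphereMap} {V : S2 → E3} {p : S2} {u w : E3}
    (hw : ⟪((φ p : S2) : E3), w⟫ = 0) : ⟪w, covDeriv φ V p u⟫ = ⟪w, sder V p u⟫ := by
  rw [covDeriv_eq, inner_sub_right, inner_smul_right, real_inner_comm ((φ p : S2) : E3) w, hw,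
    mul_zero, sub_zero]

theorem InKernel.covDeriv_cross {φ : SphereMap} {K : SmoothSection φ} (hK : InKernel K) (p : S2)
    (u : E3) : covDeriv φ K.toFun p (cross p u)
      = cross (φ p : S2) (covDeriv φ K.toFun p u) := by
  have h := sub_eq_zero.1 (hK p _ (inner_tangential p u))
  rwa [cross_sub_right, cross_smul_right, cross_self, smul_zero, sub_zero,
    covDeriv_eq φ _ p (u - _),
    ← sder_congr_tangent K.sphereSmooth, ← covDeriv_eq] at h

/-- The second variation along the product of a holomorphic section with a function. -/
theorem hessian_mulFun {φ : SphereMap} (hφ : IsHolomorphic φ) {Y : SmoothSection φ}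
    (hY : InKernel Y) {c : S2 → ℝ} (hc : SphereSmooth c) :
    hessian (Y.mulFun hc) (Y.mulFun hc)
      = ∫ p, (∑ i, sder c p (basisVec i) ^ 2) * ‖Y.toFun p‖ ^ 2 ∂area := by
  rw [hessian_self_of_isHolomorphic hφ, ← integral_const_mul]
  congr 1
  funext p
  have h1 : ∀ i, ‖covDeriv φ (Y.mulFun hc).toFun p (cross p (basisVec i))
      - cross (φ p : S2) (covDeriv φ (Y.mulFun hc).toFun p (basisVec i))‖ ^ 2
      = (sder c p (cross p (basisVec i)) ^ 2 + sder c p (basisVec i) ^ 2) * ‖Y.toFun p‖ ^ 2 := by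
    intro i
    -- As `𝔇Y = 0`, only derivatives of `c` survive. Since `Y` and `JY` are orthogonal of equal
    -- length, the squared norm splits into a sum.
    have h2 : covDeriv φ (Y.mulFun hc).toFun p (cross p (basisVec i))
        - cross (φ p : S2) (covDeriv φ (Y.mulFun hc).toFun p (basisVec i))
        = sder c p (cross p (basisVec i)) • Y.toFun p
          - sder c p (basisVec i) • cross (φ p : S2) (Y.toFun p) := by
      rw [covDeriv_mulFun, covDeriv_mulFun, hY.covDeriv_cross, cross_add_right, cross_smul_right,
        cross_smul_right]
      module
    rw [h2, norm_sub_sq_real, norm_smul, norm_smul, mul_pow, mul_pow, norm_sq_cross, norm_coe,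
      Y.tangent, inner_smul_left, inner_smul_right, inner_cross_self_right, Real.norm_eq_abs,
      Real.norm_eq_abs, sq_abs, sq_abs]
    ring
  have h3 := sum_norm_sq_cross (fderiv ℝ (fun x => c (radialProj x)) (p : E3)) p (sder_self hc p)
  simp only [Real.norm_eq_abs, sq_abs] at h3
  have h4 : ∑ i, sder c p (cross p (basisVec i)) ^ 2 = ∑ i, sder c p (basisVec i) ^ 2 := h3
  simp only [h1, ← Finset.sum_mul, Finset.sum_add_distrib, h4]
  ring

theorem sder_height_fun {g : ℝ → ℝ} {g' : ℝ} {p : S2} (hg : HasDerivAt g g' ((p : E3) 2)) (u : E3) :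
    sder (fun p : S2 => g ((p : E3) 2)) p u = g' * (u 2 - ⟪(p : E3), u⟫ * (p : E3) 2) := by
  rw [sder_comp (sphereSmooth_coord 2) p hg.differentiableAt, sder_coord, hg.hasFDerivAt.fderiv]
  simp [mul_comm]

theorem sphereSmooth_height_fun {g : ℝ → ℝ} (hg : ∀ s ∈ Set.Icc (-1 : ℝ) 1, ContDiffAt ℝ ∞ g s) :
    SphereSmooth fun p : S2 => g ((p : E3) 2) :=
  (sphereSmooth_coord 2).comp_contDiffAt fun p => hg _ (height_mem_Icc p)

/-- The holomorphic vector field `∂/∂z` of the sphere, up to normalization. -/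
def confField (q : E3) : E3 := basisVec 0 - q 0 • q + cross q (basisVec 1)

theorem fderiv_confField (q v : E3) : DifferentiableAt ℝ confField q ∧
    fderiv ℝ confField q v = cross v (basisVec 1) - q 0 • v - v 0 • q := by
  have h1 : HasFDerivAt (fun x : E3 => x 0) (EuclideanSpace.proj 0 : E3 →L[ℝ] ℝ) q :=
    (EuclideanSpace.proj 0 : E3 →L[ℝ] ℝ).hasFDerivAt
  have h2 : HasFDerivAt (fun x : E3 => cross x (basisVec 1)) (crossL.flip (basisVec 1)) q :=
    (crossL.flip (basisVec 1)).hasFDerivAt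
  have h3 := ((h1.smul (hasFDerivAt_id q)).const_sub (basisVec 0)).add h2
  have h4 : HasFDerivAt confField _ q := h3
  refine ⟨h4.differentiableAt, ?_⟩
  rw [h4.fderiv]
  simp [crossL_apply]
  module

theorem contDiff_confField : ContDiff ℝ ∞ confField := by
  have h2 : ContDiff ℝ ∞ fun x : E3 => cross x (basisVec 1) :=
    (crossL.flip (basisVec 1)).contDiff
  exact (contDiff_const.sub ((contDiff_coord 0).smul contDiff_id)).add h2

theorem inner_confField (q : S2) : ⟪(q : E3), confField q⟫ = 0 := by
  have h := height_mem q
  rw [inner_eq_coord]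
  simp [confField, basisVec, cross]
  linear_combination (-(q : E3) 0) * h

theorem norm_sq_confField (q : S2) : ‖confField q‖ ^ 2 = (1 - (q : E3) 2) ^ 2 := by
  have h := height_mem q
  rw [norm_sq_eq_coord]
  simp [confField, basisVec, cross]
  linear_combination ((q : E3) 0 ^ 2) * h

/-- The covariant derivative of `confField` is complex linear. -/
theorem fderiv_confField_tangent (q : S2) {v : E3} (hv : ⟪(q : E3), v⟫ = 0) :
    fderiv ℝ confField q v - ⟪(q : E3), fderiv ℝ confField q v⟫ • (q : E3)
      = (-(q : E3) 0) • v - (q : E3) 1 • cross q v := by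
  have h := height_mem q
  rw [(fderiv_confField q v).2, inner_eq_coord]
  rw [inner_eq_coord] at hv
  ext i
  fin_cases i <;> simp [basisVec, cross]
  · linear_combination (v 2 + (q : E3) 0 * v 0) * h + ((q : E3) 0 ^ 2 - (q : E3) 2) * hv
  · linear_combination ((q : E3) 1 * v 0) * h + ((q : E3) 1 * (q : E3) 0) * hv
  · linear_combination (((q : E3) 2 - 1) * v 0) * h + ((q : E3) 0 * (1 + (q : E3) 2)) * hv

/-- Away from the south pole this expresses `confField` through the scaling and rotation fields,
which `φ_μ` respects. It is the form in which the Cauchy-Riemann computation closes up. -/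
theorem confField_eq (q : S2) : (1 + (q : E3) 2) • confField q
    = (q : E3) 0 • heightGrad q - (q : E3) 1 • cross (basisVec 2) q := by
  have h := height_mem q
  ext i
  fin_cases i <;> simp [confField, heightGrad, basisVec, cross]
  all_goals first | linear_combination -h | ring1

/-- The section `confField ∘ φ`. -/
def confSection (φ : SphereMap) : SmoothSection φ where
  toFun p := confField (φ p : S2)
  smooth := (φ.sphereSmooth.comp_contDiffAt fun _ => contDiff_confField.contDiffAt).contMDiff
  tangent p := inner_confField (φ p)

theorem sder_confSection (φ : SphereMap) (p : S2) (u : E3) : sder (confSection φ).toFun p u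
    = fderiv ℝ confField (φ p : S2) (sder (fun p => ((φ p : S2) : E3)) p u) :=
  sder_comp φ.sphereSmooth p (fderiv_confField _ 0).1 u

theorem covDeriv_confSection (φ : SphereMap) (p : S2) (u : E3) :
    covDeriv φ (confSection φ).toFun p u
      = (-((φ p : S2) : E3) 0) • sder (fun p => ((φ p : S2) : E3)) p u
        - ((φ p : S2) : E3) 1 • cross (φ p : S2) (sder (fun p => ((φ p : S2) : E3)) p u) := by
  rw [covDeriv_eq, sder_confSection, fderiv_confField_tangent _ (inner_sder_self_eq_zero φ p u)]

theorem inKernel_confSection {φ : SphereMap} (hφ : IsHolomorphic φ) :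
    InKernel (confSection φ) := by
  intro p u _
  rw [covDeriv_confSection, covDeriv_confSection, hφ, cross_sub_right, cross_smul_right,
    cross_smul_right, sub_self]

/-! ### Orthogonality to the kernel of `𝔇`. -/

section

variable (μ : Set.Ioi (0 : ℝ)) (p : S2)

theorem inner_heightGrad : ⟪(p : E3), heightGrad p⟫ = 0 := by
  rw [heightGrad, inner_sub_right, inner_smul_right, inner_coe_self, real_inner_comm,
    inner_basisVec]
  ring

theorem cross_cross_basisVec_two : cross p (cross (basisVec 2) p) = heightGrad p := by
  have h := height_mem p
  ext i
  fin_cases i <;> simp [heightGrad, basisVec, cross]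
  linear_combination h

theorem sder_lump_rotation : sder (fun p => ((lump μ p : S2) : E3)) p (cross (basisVec 2) p)
    = cross (basisVec 2) (lump μ p : S2) := by
  have hT : ⟪(p : E3), cross (basisVec 2) p⟫ = 0 := inner_cross_self_right _ _
  ext i
  fin_cases i
  · simp only [Fin.zero_eta]
    rw [sder_lump_zero μ hT]
    simp [basisVec, cross, lump_one]
    ring
  · simp only [Fin.mk_one]
    rw [sder_lump_one μ hT]
    simp [basisVec, cross, lump_zero]
  · simp only [Fin.reduceFinMk]
    rw [sder_lump_two μ hT]
    simp [basisVec, cross]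

/-- `φ_μ` commutes with rotations about the axis. The height gradient is `J` applied to the rotation
field, so holomorphy transfers the property to it. -/
theorem sder_lump_heightGrad : sder (fun p => ((lump μ p : S2) : E3)) p (heightGrad p)
    = heightGrad (lump μ p : S2) := by
  rw [← cross_cross_basisVec_two, isHolomorphic_lump, sder_lump_rotation,
    cross_cross_basisVec_two]

variable {μ} in
/-- The Cauchy-Riemann equation for the pairing of two holomorphic sections. -/
theorem cauchyRiemann_confSection {K : SmoothSection (lump μ)} (hK : InKernel K) :
    sder (fun p => ⟪(confSection (lump μ)).toFun p, K.toFun p⟫) p (heightGrad p)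
      + sder (fun p => ⟪cross (lump μ p : S2) ((confSection (lump μ)).toFun p), K.toFun p⟫) p
        (cross (basisVec 2) p)
      = -2 * (1 + ((lump μ p : S2) : E3) 2) * ⟪(confSection (lump μ)).toFun p, K.toFun p⟫ := by
  set X := confSection (lump μ) with hX
  have sX := X.sphereSmooth
  have sK := K.sphereSmooth
  have sΦ := (lump μ).sphereSmooth
  set q : E3 := ((lump μ p : S2) : E3) with hq
  have hKt : ⟪q, K.toFun p⟫ = 0 := K.tangent p
  have hXq : ⟪q, X.toFun p⟫ = 0 := X.tangent p
  -- Writing `K = k X` away from the zero of `X`, the identity says that `k` is holomorphic, the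
  -- factor `-2(1 + q 2)` being the derivative of `log |X|² = 2 log(1 - q 2)` along the height
  -- gradient. The proof avoids the division: this step removes the derivatives of `K`, and those of
  -- `X` are computed explicitly.
  have h1 : ⟪X.toFun p, sder K.toFun p (heightGrad p)⟫
      = -⟪cross q (X.toFun p), sder K.toFun p (cross (basisVec 2) p)⟫ := by
    rw [← inner_covDeriv_of_tangent (φ := lump μ) hXq, ← cross_cross_basisVec_two,
      hK.covDeriv_cross, inner_cross_swap,
      inner_covDeriv_of_tangent (inner_cross_self_left _ _)]
  have hcov : ∀ u, ⟪sder X.toFun p u, K.toFun p⟫ = ⟪covDeriv (lump μ) X.toFun p u, K.toFun p⟫ :=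
    fun u => by
      rw [real_inner_comm, real_inner_comm (K.toFun p) (covDeriv _ _ _ _),
        inner_covDeriv_of_tangent (K.tangent p)]
  have hcov' : ∀ u, ⟪cross q (sder X.toFun p u), K.toFun p⟫
      = ⟪cross q (covDeriv (lump μ) X.toFun p u), K.toFun p⟫ := fun u => by
    rw [covDeriv_eq, cross_sub_right, cross_smul_right, cross_self, smul_zero, sub_zero]
  have h2 : cross (cross (basisVec 2) q) (X.toFun p) = X.toFun p 2 • q := by
    rw [cross_cross_left, hXq, zero_smul, sub_zero, inner_basisVec]
  have hJ : cross q (heightGrad q) = -cross (basisVec 2) q := by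
    rw [heightGrad, cross_sub_right, cross_smul_right, cross_self, smul_zero, sub_zero,
      cross_anticomm]
  rw [sder_inner sX sK, sder_inner (sΦ.cross sX) sK, sder_cross sΦ sX, sder_lump_rotation,
    inner_add_left, hcov, hcov', covDeriv_confSection, covDeriv_confSection, sder_lump_heightGrad,
    sder_lump_rotation, ← hq, h1, h2, cross_sub_right, cross_smul_right, cross_smul_right,
    cross_cross_basisVec_two, hJ]
  have h3 := congrArg (fun v => ⟪v, K.toFun p⟫) (confField_eq (lump μ p))
  simp only [inner_sub_left, inner_smul_left, inner_neg_left, conj_trivial] at h3 ⊢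
  have h4 : (1 + q 2) * ⟪X.toFun p, K.toFun p⟫
    = q 0 * ⟪heightGrad q, K.toFun p⟫ - q 1 * ⟪cross (basisVec 2) q, K.toFun p⟫ := h3
  rw [hKt, ← hq]
  linear_combination 2 * h4

variable {μ} in
/-- Radial functions in the range of the adjoint of `𝔇` are orthogonal to its kernel. -/
theorem integral_mul_inner_kernel {K : SmoothSection (lump μ)} (hK : InKernel K) {H H' : ℝ → ℝ}
    (hs : ∀ s ∈ Set.Icc (-1 : ℝ) 1, ContDiffAt ℝ ∞ H s)
    (hd : ∀ s ∈ Set.Icc (-1 : ℝ) 1, HasDerivAt H (H' s) s) :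
    ∫ p : S2, ((1 - (p : E3) 2 ^ 2) * H' ((p : E3) 2) - 2 * (p : E3) 2 * H ((p : E3) 2)
      - 2 * (1 + ((lump μ p : S2) : E3) 2) * H ((p : E3) 2))
      * ⟪(confSection (lump μ)).toFun p, K.toFun p⟫ ∂area = 0 := by
  have sH := sphereSmooth_height_fun hs
  have sX := (confSection (lump μ)).sphereSmooth
  have sK := K.sphereSmooth
  have su := sX.inner sK
  have sv := ((lump μ).sphereSmooth.cross sX).inner sK
  have i1 := integral_div_heightGrad (sH.mul su)
  have i2 := integral_sder_cross (norm_basisVec 2) (sH.mul sv)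
  have cN : Continuous fun p : S2 => heightGrad p :=
    continuous_const.sub ((sphereSmooth_coord 2).continuous.smul continuous_subtype_val)
  have cT : Continuous fun p : S2 => cross (basisVec 2) p :=
    (crossL (basisVec 2)).continuous.comp continuous_subtype_val
  have c1 : Continuous fun p : S2 => sder (fun p => H ((p : E3) 2)
      * ⟪(confSection (lump μ)).toFun p, K.toFun p⟫) p (heightGrad p)
      - 2 * (p : E3) 2 * (H ((p : E3) 2) * ⟪(confSection (lump μ)).toFun p, K.toFun p⟫) :=
    ((sH.mul su).continuous_sder cN).sub
      ((continuous_const.mul (sphereSmooth_coord 2).continuous).mul (sH.mul su).continuous)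
  have c2 := (sH.mul sv).continuous_sder cT
  have i3 := integral_add (integrable_of_continuous c1) (integrable_of_continuous c2)
  rw [i2, add_zero] at i3
  rw [← i1, ← i3]
  congr 1
  funext p
  have hp := height_mem p
  have hcr := cauchyRiemann_confSection p hK
  have hdp := hd _ (height_mem_Icc p)
  rw [sder_mul sH su, sder_mul sH sv, sder_height_fun hdp, sder_height_fun hdp,
    inner_heightGrad, inner_cross_self_right]
  have hN : heightGrad p 2 = 1 - (p : E3) 2 ^ 2 := by simp [heightGrad, basisVec]; ring
  have hT : cross (basisVec 2) p 2 = 0 := by simp [basisVec, cross]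
  rw [hN, hT]
  -- `H` is constant along the rotation field, so its derivative enters only through the height
  -- gradient, with coefficient `1 - s²`.
  linear_combination -H ((p : E3) 2) * hcr

end

/-! ### Radial functions of the test section and their pointwise bounds. -/

/-- The logarithmic cutoff, equal to one at the south pole and to zero at the north pole. -/
def logCut (μ s : ℝ) : ℝ := 1 - (Real.log (μ ^ 2))⁻¹ * Real.log (lumpDenom μ s / 2)

/-- The radial function whose image under the adjoint of `𝔇` is `testFun`. -/
def testPrimitive (μ s : ℝ) : ℝ := lumpDenom μ s * logCut μ s

/-- The radial factor of the test section. -/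
def testFun (μ s : ℝ) : ℝ := (4 - 8 * (1 + s) - 3 * (μ ^ 2 - 1) * (1 + s) ^ 2) * logCut μ s
  - (Real.log (μ ^ 2))⁻¹ * (μ ^ 2 - 1) * ((1 + s) * (1 - s))

/-- The derivative of `testFun`. -/
def testFunDeriv (μ s : ℝ) : ℝ := (-8 - 6 * (μ ^ 2 - 1) * (1 + s)) * logCut μ s
  - (4 - 8 * (1 + s) - 3 * (μ ^ 2 - 1) * (1 + s) ^ 2)
    * ((Real.log (μ ^ 2))⁻¹ * ((μ ^ 2 - 1) / lumpDenom μ s))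
  - (Real.log (μ ^ 2))⁻¹ * (μ ^ 2 - 1) * (-2 * s)

section

variable {μ s : ℝ}

theorem contDiff_lumpDenom (μ : ℝ) : ContDiff ℝ ∞ (lumpDenom μ) := by
  unfold lumpDenom; fun_prop

theorem hasDerivAt_lumpDenom (μ s : ℝ) : HasDerivAt (lumpDenom μ) (μ ^ 2 - 1) s := by
  have h := ((hasDerivAt_id' s).const_mul (μ ^ 2 - 1)).const_add (1 + μ ^ 2)
  rw [mul_one] at h
  exact h.congr_of_eventuallyEq (Eventually.of_forall fun s => lumpDenom_eq_affine μ s)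

theorem contDiffAt_log_lumpDenom (h : 0 < lumpDenom μ s) :
    ContDiffAt ℝ ∞ (fun s => Real.log (lumpDenom μ s / 2)) s :=
  ((contDiff_lumpDenom μ).contDiffAt.div_const 2).log (by positivity)

theorem hasDerivAt_log_lumpDenom (h : 0 < lumpDenom μ s) :
    HasDerivAt (fun s => Real.log (lumpDenom μ s / 2)) ((μ ^ 2 - 1) / lumpDenom μ s) s := by
  refine (((hasDerivAt_lumpDenom μ s).div_const 2).log (by positivity)).congr_deriv ?_
  field_simp

theorem contDiffAt_logCut (h : 0 < lumpDenom μ s) : ContDiffAt ℝ ∞ (logCut μ) s :=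
  contDiffAt_const.sub (contDiffAt_const.mul (contDiffAt_log_lumpDenom h))

theorem hasDerivAt_logCut (h : 0 < lumpDenom μ s) :
    HasDerivAt (logCut μ) (-((Real.log (μ ^ 2))⁻¹ * ((μ ^ 2 - 1) / lumpDenom μ s))) s :=
  ((hasDerivAt_log_lumpDenom h).const_mul _).const_sub 1

theorem contDiffAt_testPrimitive (h : 0 < lumpDenom μ s) :
    ContDiffAt ℝ ∞ (testPrimitive μ) s :=
  (contDiff_lumpDenom μ).contDiffAt.mul (contDiffAt_logCut h)

theorem hasDerivAt_testPrimitive (h : 0 < lumpDenom μ s) : HasDerivAt (testPrimitive μ)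
    ((μ ^ 2 - 1) * (logCut μ s - (Real.log (μ ^ 2))⁻¹)) s := by
  refine ((hasDerivAt_lumpDenom μ s).mul (hasDerivAt_logCut h)).congr_deriv ?_
  field_simp
  ring

theorem contDiffAt_testFun (h : 0 < lumpDenom μ s) : ContDiffAt ℝ ∞ (testFun μ) s := by
  have := contDiffAt_logCut h
  unfold testFun
  fun_prop

theorem hasDerivAt_testFun (h : 0 < lumpDenom μ s) :
    HasDerivAt (testFun μ) (testFunDeriv μ s) s := by
  have h1 : HasDerivAt (fun s => 4 - 8 * (1 + s) - 3 * (μ ^ 2 - 1) * (1 + s) ^ 2)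
      (-8 - 6 * (μ ^ 2 - 1) * (1 + s)) s := by
    have h2 := (hasDerivAt_id' s).const_add 1
    refine (((h2.const_mul 8).const_sub 4).sub ((h2.pow 2).const_mul
      (3 * (μ ^ 2 - 1)))).congr_deriv ?_
    simp
    ring
  have h3 : HasDerivAt (fun s : ℝ => (1 + s) * (1 - s)) (-2 * s) s := by
    refine (((hasDerivAt_id' s).const_add 1).mul
      ((hasDerivAt_id' s).const_sub 1)).congr_deriv ?_
    ring
  refine ((h1.mul (hasDerivAt_logCut h)).sub (h3.const_mul _)).congr_deriv ?_
  unfold testFunDeriv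
  ring

/-- The denominator disappears because `d (1 + q 2) = 2 μ² (1 + s)`. -/
theorem testFun_eq (h : lumpDenom μ s ≠ 0) : testFun μ s
    = (1 - s ^ 2) * ((μ ^ 2 - 1) * (logCut μ s - (Real.log (μ ^ 2))⁻¹))
      - 2 * s * testPrimitive μ s
      - 2 * (1 + (μ ^ 2 - 1 + (μ ^ 2 + 1) * s) / lumpDenom μ s) * testPrimitive μ s := by
  unfold testFun testPrimitive
  field_simp
  rw [lumpDenom_eq_affine]
  ring

theorem two_le_lumpDenom (hμ : 1 < μ) (hs : s ∈ Set.Icc (-1 : ℝ) 1) : 2 ≤ lumpDenom μ s := by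
  unfold lumpDenom
  nlinarith [hs.1, mul_nonneg (by nlinarith : 0 ≤ μ ^ 2 - 1) (by linarith [hs.1] : 0 ≤ 1 + s)]

theorem lumpDenom_le (hμ : 1 < μ) (hs : s ∈ Set.Icc (-1 : ℝ) 1) : lumpDenom μ s ≤ 2 * μ ^ 2 := by
  unfold lumpDenom
  nlinarith [hs.2, mul_nonneg (by nlinarith : 0 ≤ μ ^ 2 - 1) (by linarith [hs.2] : 0 ≤ 1 - s)]

theorem log_sq_pos (hμ : 1 < μ) : 0 < Real.log (μ ^ 2) := Real.log_pos (by nlinarith)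

theorem log_lumpDenom_nonneg (hμ : 1 < μ) (hs : s ∈ Set.Icc (-1 : ℝ) 1) :
    0 ≤ Real.log (lumpDenom μ s / 2) :=
  Real.log_nonneg (by linarith [two_le_lumpDenom hμ hs])

theorem log_lumpDenom_le (hμ : 1 < μ) (hs : s ∈ Set.Icc (-1 : ℝ) 1) :
    Real.log (lumpDenom μ s / 2) ≤ Real.log (μ ^ 2) :=
  Real.log_le_log (by linarith [two_le_lumpDenom hμ hs]) (by linarith [lumpDenom_le hμ hs])

theorem logCut_nonneg (hμ : 1 < μ) (hs : s ∈ Set.Icc (-1 : ℝ) 1) : 0 ≤ logCut μ s := by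
  have h := log_sq_pos hμ
  unfold logCut
  rw [sub_nonneg, inv_mul_le_one₀ h]
  exact log_lumpDenom_le hμ hs

theorem one_sub_logCut_nonneg (hμ : 1 < μ) (hs : s ∈ Set.Icc (-1 : ℝ) 1) :
    0 ≤ 1 - logCut μ s := by
  have h := log_sq_pos hμ
  have h2 := log_lumpDenom_nonneg hμ hs
  unfold logCut
  rw [sub_sub_cancel]
  positivity

theorem one_sub_logCut_le (hμ : 1 < μ) (hs : s ∈ Set.Icc (-1 : ℝ) 1) :
    1 - logCut μ s ≤ (Real.log (μ ^ 2))⁻¹ * (lumpDenom μ s / 2) := by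
  have h := log_sq_pos hμ
  have h2 := two_le_lumpDenom hμ hs
  unfold logCut
  rw [sub_sub_cancel]
  gcongr
  exact Real.log_le_self (by linarith)

/-- The cutoff equals `ε log(2μ²/d)`. Using `log x ≤ x` and `d ≥ μ²(1 + s)` gives the bound. -/
theorem mul_logCut_le (hμ : 1 < μ) (hs : s ∈ Set.Icc (-1 : ℝ) 1) :
    (1 + s) * logCut μ s ≤ 2 * (Real.log (μ ^ 2))⁻¹ := by
  have h := log_sq_pos hμ
  have h2 := two_le_lumpDenom hμ hs
  have h3 : 0 ≤ 1 + s := by linarith [hs.1]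
  have h4 : logCut μ s = (Real.log (μ ^ 2))⁻¹ * Real.log (μ ^ 2 / (lumpDenom μ s / 2)) := by
    rw [Real.log_div (by positivity) (by positivity), logCut]
    field_simp
  have h5 : Real.log (μ ^ 2 / (lumpDenom μ s / 2)) ≤ μ ^ 2 / (lumpDenom μ s / 2) :=
    Real.log_le_self (by positivity)
  have h6 : (1 + s) * (μ ^ 2 / (lumpDenom μ s / 2)) ≤ 2 := by
    rw [← mul_div_assoc, div_le_iff₀ (by linarith)]
    unfold lumpDenom
    nlinarith [hs.2]
  rw [h4]
  calc (1 + s) * ((Real.log (μ ^ 2))⁻¹ * Real.log (μ ^ 2 / (lumpDenom μ s / 2)))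
      = (Real.log (μ ^ 2))⁻¹ * ((1 + s) * Real.log (μ ^ 2 / (lumpDenom μ s / 2))) := by ring
    _ ≤ (Real.log (μ ^ 2))⁻¹ * 2 := by
        gcongr
        exact (mul_le_mul_of_nonneg_left h5 h3).trans h6
    _ = _ := by ring

theorem abs_testFunDeriv_le (hμ : 1 < μ) (hs : s ∈ Set.Icc (-1 : ℝ) 1) : |testFunDeriv μ s|
    ≤ 6 * lumpDenom μ s * logCut μ s + 18 * ((Real.log (μ ^ 2))⁻¹ * (μ ^ 2 - 1)) := by
  have hε : 0 < (Real.log (μ ^ 2))⁻¹ := inv_pos.2 (log_sq_pos hμ)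
  have hL := logCut_nonneg hμ hs
  have hd := two_le_lumpDenom hμ hs
  have hβ : 0 ≤ μ ^ 2 - 1 := by nlinarith
  have hu : 0 ≤ 1 + s := by linarith [hs.1]
  have hβu := mul_nonneg hβ hu
  have hde : lumpDenom μ s = 2 + (μ ^ 2 - 1) * (1 + s) := by unfold lumpDenom; ring
  unfold testFunDeriv
  generalize (Real.log (μ ^ 2))⁻¹ = ε at *
  generalize logCut μ s = L at *
  generalize lumpDenom μ s = d at *
  have h1 : |(-8 - 6 * (μ ^ 2 - 1) * (1 + s)) * L| ≤ 6 * d * L := by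
    rw [abs_mul, abs_of_nonneg hL]
    gcongr
    rw [abs_le]
    constructor <;> linarith
  have h2 : |(4 - 8 * (1 + s) - 3 * (μ ^ 2 - 1) * (1 + s) ^ 2) * (ε * ((μ ^ 2 - 1) / d))|
      ≤ 16 * (ε * (μ ^ 2 - 1)) := by
    have h3 : |4 - 8 * (1 + s) - 3 * (μ ^ 2 - 1) * (1 + s) ^ 2| ≤ 16 * d := by
      have h4 : (μ ^ 2 - 1) * (1 + s) ^ 2 ≤ 2 * ((μ ^ 2 - 1) * (1 + s)) := by
        nlinarith [hs.2]
      have h5 : 0 ≤ (μ ^ 2 - 1) * (1 + s) ^ 2 := by positivity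
      rw [abs_le]
      constructor <;> nlinarith [hs.2]
    have h6 : 0 ≤ ε * ((μ ^ 2 - 1) / d) := by positivity
    rw [abs_mul, abs_of_nonneg h6]
    calc _ ≤ 16 * d * (ε * ((μ ^ 2 - 1) / d)) := by gcongr
      _ = _ := by field_simp
  have h7 : |ε * (μ ^ 2 - 1) * (-2 * s)| ≤ 2 * (ε * (μ ^ 2 - 1)) := by
    have h8 : 0 ≤ ε * (μ ^ 2 - 1) := by positivity
    have h9 : |-2 * s| ≤ 2 := by rw [abs_le]; constructor <;> linarith [hs.1, hs.2]
    rw [abs_mul, abs_of_nonneg h8, mul_comm]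
    gcongr
  refine (abs_sub _ _).trans ?_
  linarith [abs_sub ((-8 - 6 * (μ ^ 2 - 1) * (1 + s)) * L)
    ((4 - 8 * (1 + s) - 3 * (μ ^ 2 - 1) * (1 + s) ^ 2) * (ε * ((μ ^ 2 - 1) / d)))]

/-- The factor `|X|² = (2(1 - s)/d)²` cancels the growth `d` of `g'`. One power of the cutoff,
paired with `1 + s`, then supplies the `ε` in the first term. The second term is `ε²` times the
squared gradient of `log d`, whose integral is only `O(1/ε)`. -/
theorem testFunDeriv_sq_mul_le (hμ : 1 < μ) (hs : s ∈ Set.Icc (-1 : ℝ) 1) :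
    testFunDeriv μ s ^ 2 * (1 - s ^ 2) * (2 * (1 - s) / lumpDenom μ s) ^ 2
      ≤ 4608 * (Real.log (μ ^ 2))⁻¹ + 10368 * (Real.log (μ ^ 2))⁻¹ ^ 2
        * ((μ ^ 2 - 1) ^ 2 * (1 - s ^ 2) / lumpDenom μ s ^ 2) := by
  have hε : 0 < (Real.log (μ ^ 2))⁻¹ := inv_pos.2 (log_sq_pos hμ)
  have hL := logCut_nonneg hμ hs
  have hL1 : logCut μ s ≤ 1 := by linarith [one_sub_logCut_nonneg hμ hs]
  have huL := mul_logCut_le hμ hs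
  have hd := two_le_lumpDenom hμ hs
  have hβ : 0 ≤ μ ^ 2 - 1 := by nlinarith
  have hu : 0 ≤ 1 + s := by linarith [hs.1]
  have hv : 0 ≤ 1 - s := by linarith [hs.2]
  have hv2 : 1 - s ≤ 2 := by linarith [hs.1]
  have hg := abs_testFunDeriv_le hμ hs
  generalize (Real.log (μ ^ 2))⁻¹ = ε at *
  generalize logCut μ s = L at *
  generalize testFunDeriv μ s = g at *
  generalize lumpDenom μ s = d at *
  have hd0 : 0 < d := by linarith
  have h1 : g ^ 2 ≤ 72 * (d ^ 2 * L ^ 2) + 648 * (ε ^ 2 * (μ ^ 2 - 1) ^ 2) := by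
    have h2 : g ^ 2 ≤ (6 * d * L + 18 * (ε * (μ ^ 2 - 1))) ^ 2 :=
      sq_le_sq' (abs_le.1 hg).1 (abs_le.1 hg).2
    nlinarith [sq_nonneg (6 * d * L - 18 * (ε * (μ ^ 2 - 1)))]
  have h3 : (1 - s) ^ 3 ≤ 8 := by
    calc (1 - s) ^ 3 ≤ 2 ^ 3 := by gcongr
      _ = 8 := by norm_num
  have h4 : (1 - s) ^ 2 ≤ 4 := by
    calc (1 - s) ^ 2 ≤ 2 ^ 2 := by gcongr
      _ = 4 := by norm_num
  have h5 : ((1 + s) * L) * (L * (1 - s) ^ 3) ≤ (2 * ε) * (1 * 8) := by gcongr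
  have h6 : (1 - s ^ 2) = (1 + s) * (1 - s) := by ring
  have h7 : 0 ≤ (μ ^ 2 - 1) ^ 2 * ((1 + s) * (1 - s)) / d ^ 2 := by positivity
  rw [h6]
  calc g ^ 2 * ((1 + s) * (1 - s)) * (2 * (1 - s) / d) ^ 2
      ≤ (72 * (d ^ 2 * L ^ 2) + 648 * (ε ^ 2 * (μ ^ 2 - 1) ^ 2)) * ((1 + s) * (1 - s))
        * (2 * (1 - s) / d) ^ 2 := by gcongr
    _ = 288 * (((1 + s) * L) * (L * (1 - s) ^ 3)) + 2592 * ε ^ 2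
        * ((μ ^ 2 - 1) ^ 2 * ((1 + s) * (1 - s)) / d ^ 2) * (1 - s) ^ 2 := by
        field_simp
        ring
    _ ≤ 288 * ((2 * ε) * (1 * 8)) + 2592 * ε ^ 2
        * ((μ ^ 2 - 1) ^ 2 * ((1 + s) * (1 - s)) / d ^ 2) * 4 := by gcongr
    _ = _ := by ring

/-- Each part of `4 - g` carries a factor `ε`: `1 - logCut` by `log x ≤ x`, the polynomial part
through `(1 + s) logCut ≤ 2ε`, and the last term explicitly. -/
theorem testFun_le (hμ : 1 < μ) (hs : s ∈ Set.Icc (-1 : ℝ) 1) :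
    4 - testFun μ s ≤ 12 * (Real.log (μ ^ 2))⁻¹ * lumpDenom μ s := by
  have hε : 0 < (Real.log (μ ^ 2))⁻¹ := inv_pos.2 (log_sq_pos hμ)
  have hL1 := one_sub_logCut_le hμ hs
  have huL := mul_logCut_le hμ hs
  have hβ : 0 ≤ μ ^ 2 - 1 := by nlinarith
  have hu : 0 ≤ 1 + s := by linarith [hs.1]
  have hβu := mul_nonneg hβ hu
  have hde : lumpDenom μ s = 2 + (μ ^ 2 - 1) * (1 + s) := by unfold lumpDenom; ring
  unfold testFun
  generalize (Real.log (μ ^ 2))⁻¹ = ε at *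
  generalize logCut μ s = L at *
  generalize lumpDenom μ s = d at *
  have h1 : (8 + 3 * ((μ ^ 2 - 1) * (1 + s))) * ((1 + s) * L)
      ≤ (8 + 3 * ((μ ^ 2 - 1) * (1 + s))) * (2 * ε) := by gcongr
  have h2 : ε * ((μ ^ 2 - 1) * (1 + s)) * (1 - s) ≤ ε * ((μ ^ 2 - 1) * (1 + s)) * 2 := by
    gcongr
    linarith [hs.1]
  have h3 : 0 ≤ ε * ((μ ^ 2 - 1) * (1 + s)) := by positivity
  rw [hde] at hL1 ⊢
  linarith

/-- The weighted mass of the test section is bounded below, pointwise up to a divergence. -/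
theorem le_density_mul_testFun_sq (hμ : 1 < μ) (hs : s ∈ Set.Icc (-1 : ℝ) 1) :
    16 * (lumpDensity μ s - 2 * (lumpDensity μ s
        * ((μ ^ 2 - 1 + (μ ^ 2 + 1) * s) / lumpDenom μ s)))
      - 768 * (Real.log (μ ^ 2))⁻¹ * lumpDensity μ s
      ≤ lumpDensity μ s * (testFun μ s ^ 2 * (2 * (1 - s) / lumpDenom μ s) ^ 2) := by
  have hε : 0 < (Real.log (μ ^ 2))⁻¹ := inv_pos.2 (log_sq_pos hμ)
  have hd := two_le_lumpDenom hμ hs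
  have hg := testFun_le hμ hs
  have hw : 0 ≤ lumpDensity μ s := by unfold lumpDensity; positivity
  have hq : 2 * (1 - s) / lumpDenom μ s
      = 1 - (μ ^ 2 - 1 + (μ ^ 2 + 1) * s) / lumpDenom μ s := by
    have : lumpDenom μ s ≠ 0 := by positivity
    field_simp
    rw [lumpDenom_eq_affine]
    ring
  have hm : (2 * (1 - s) / lumpDenom μ s) ^ 2 * lumpDenom μ s ≤ 8 := by
    have h1 : (2 * (1 - s) / lumpDenom μ s) ^ 2 * lumpDenom μ s
        = 4 * (1 - s) ^ 2 / lumpDenom μ s := by field_simp; ring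
    rw [h1, div_le_iff₀ (by linarith)]
    nlinarith [hs.1, hs.2]
  have hm0 : 0 ≤ (2 * (1 - s) / lumpDenom μ s) ^ 2 := by positivity
  -- Dropping the square of the target height leaves an affine function of it, whose weighted
  -- integral is known exactly.
  have hm1 : 1 - 2 * ((μ ^ 2 - 1 + (μ ^ 2 + 1) * s) / lumpDenom μ s)
      ≤ (2 * (1 - s) / lumpDenom μ s) ^ 2 := by
    rw [hq]
    nlinarith [sq_nonneg ((μ ^ 2 - 1 + (μ ^ 2 + 1) * s) / lumpDenom μ s)]
  generalize (Real.log (μ ^ 2))⁻¹ = ε at *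
  generalize (μ ^ 2 - 1 + (μ ^ 2 + 1) * s) / lumpDenom μ s = q at *
  generalize (2 * (1 - s) / lumpDenom μ s) ^ 2 = m at *
  generalize lumpDenom μ s = d at *
  generalize testFun μ s = g at *
  -- From `g² ≥ 16 - 8(4 - g)` and `4 - g ≤ 12 ε d`. With `|X|² d ≤ 8` the error becomes `96 · 8 =
  -- 768`.
  have h1 : 16 - 96 * ε * d ≤ g ^ 2 := by nlinarith [sq_nonneg (4 - g)]
  calc 16 * (lumpDensity μ s - 2 * (lumpDensity μ s * q)) - 768 * ε * lumpDensity μ s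
      = lumpDensity μ s * (16 * (1 - 2 * q) - 96 * ε * 8) := by ring
    _ ≤ lumpDensity μ s * (16 * m - 96 * ε * (m * d)) := by gcongr
    _ = lumpDensity μ s * ((16 - 96 * ε * d) * m) := by ring
    _ ≤ _ := by gcongr

end

/-! ### Three integrals evaluated or bounded by the divergence theorem. -/

section

variable {μ : ℝ}

/-- `w` is the Jacobian of a bijection of the sphere. The change of variables is replaced by the
fact that `w - 1` is the divergence of `(μ² - 1) d⁻¹ ∇s`. -/
theorem integral_lumpDensity (hμ : 1 < μ) :
    ∫ p : S2, lumpDensity μ ((p : E3) 2) ∂area = area.real Set.univ := by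
  have hd : ∀ s ∈ Set.Icc (-1 : ℝ) 1, 0 < lumpDenom μ s := fun s hs => by
    linarith [two_le_lumpDenom hμ hs]
  have h := integral_div_height (h := fun s => (lumpDenom μ s)⁻¹)
    (fun s hs => (contDiff_lumpDenom μ).contDiffAt.inv (hd s hs).ne')
    (fun s hs => (hasDerivAt_lumpDenom μ s).inv (hd s hs).ne')
  have h2 : ∀ p : S2, lumpDensity μ ((p : E3) 2) = 1 + (μ ^ 2 - 1)
      * ((1 - (p : E3) 2 ^ 2) * (-(μ ^ 2 - 1) / lumpDenom μ ((p : E3) 2) ^ 2)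
        - 2 * (p : E3) 2 * (lumpDenom μ ((p : E3) 2))⁻¹) := fun p => by
    have := (hd _ (height_mem_Icc p)).ne'
    unfold lumpDensity
    field_simp
    rw [lumpDenom_eq_affine]
    ring
  have h3 := congrArg (fun x => (μ ^ 2 - 1) * x) h
  simp only [← integral_const_mul, mul_zero] at h3
  have hw : Continuous fun p : S2 => lumpDensity μ ((p : E3) 2) :=
    continuous_lumpDensity ⟨μ, by simp; linarith⟩
  have h4 : ∫ p : S2, (lumpDensity μ ((p : E3) 2) - 1) ∂area = 0 := by
    rw [← h3]
    congr 1
    funext p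
    rw [h2]
    ring
  rw [integral_sub (integrable_of_continuous hw) (integrable_const 1)] at h4
  rw [integral_const, smul_eq_mul, mul_one] at h4
  linarith

/-- The height has mean zero on the target; concretely, the integrand is the divergence of `-2μ² d⁻²
∇s`. -/
theorem integral_lumpDensity_mul (hμ : 1 < μ) :
    ∫ p : S2, lumpDensity μ ((p : E3) 2)
      * ((μ ^ 2 - 1 + (μ ^ 2 + 1) * (p : E3) 2) / lumpDenom μ ((p : E3) 2)) ∂area = 0 := by
  have hd : ∀ s ∈ Set.Icc (-1 : ℝ) 1, 0 < lumpDenom μ s := fun s hs => by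
    linarith [two_le_lumpDenom hμ hs]
  have h := integral_div_height (h := fun s => (lumpDenom μ s ^ 2)⁻¹)
    (fun s hs => ((contDiff_lumpDenom μ).contDiffAt.pow 2).inv (pow_ne_zero 2 (hd s hs).ne'))
    (fun s hs => ((hasDerivAt_lumpDenom μ s).pow 2).inv (pow_ne_zero 2 (hd s hs).ne'))
  have h2 := congrArg (fun x => (-2 * μ ^ 2) * x) h
  simp only [← integral_const_mul, mul_zero] at h2
  rw [← h2]
  congr 1
  funext p
  have := (hd _ (height_mem_Icc p)).ne'
  simp only [lumpDensity, Pi.pow_apply]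
  field_simp
  rw [lumpDenom_eq_affine]
  simp
  ring

/-- Integration by parts of `|∇ log(d/2)|²` moves one derivative onto the other factor, leaving
`log(d/2) ≤ log μ²` times a quantity at most `1`. That last bound amounts to `(d - βs)² = (1 + μ²)²
≥ β²`. -/
theorem integral_log_gradient_le (hμ : 1 < μ) :
    ∫ p : S2, (μ ^ 2 - 1) ^ 2 * (1 - (p : E3) 2 ^ 2) / lumpDenom μ ((p : E3) 2) ^ 2 ∂area
      ≤ area.real Set.univ * Real.log (μ ^ 2) := by
  have hd : ∀ s ∈ Set.Icc (-1 : ℝ) 1, 0 < lumpDenom μ s := fun s hs => by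
    linarith [two_le_lumpDenom hμ hs]
  have h := integral_div_height
    (h := fun s => Real.log (lumpDenom μ s / 2) * ((μ ^ 2 - 1) * (lumpDenom μ s)⁻¹))
    (fun s hs => (contDiffAt_log_lumpDenom (hd s hs)).mul
      (contDiffAt_const.mul ((contDiff_lumpDenom μ).contDiffAt.inv (hd s hs).ne')))
    (fun s hs => (hasDerivAt_log_lumpDenom (hd s hs)).mul
      (((hasDerivAt_lumpDenom μ s).inv (hd s hs).ne').const_mul (μ ^ 2 - 1)))
  have cd : Continuous fun p : S2 => lumpDenom μ ((p : E3) 2) :=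
    (contDiff_lumpDenom μ).continuous.comp (by fun_prop)
  have cd0 : ∀ p : S2, lumpDenom μ ((p : E3) 2) ≠ 0 := fun p => (hd _ (height_mem_Icc p)).ne'
  have cl : Continuous fun p : S2 => Real.log (lumpDenom μ ((p : E3) 2) / 2) :=
    (cd.div_const 2).log fun p => div_ne_zero (cd0 p) two_ne_zero
  have cF : Continuous fun p : S2 =>
      (μ ^ 2 - 1) ^ 2 * (1 - (p : E3) 2 ^ 2) / lumpDenom μ ((p : E3) 2) ^ 2 :=
    Continuous.div (by fun_prop) (by fun_prop) fun p => pow_ne_zero 2 (cd0 p)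
  have ci : Continuous fun p : S2 => (lumpDenom μ ((p : E3) 2))⁻¹ := cd.inv₀ cd0
  have cq : Continuous fun p : S2 => (μ ^ 2 - 1) / lumpDenom μ ((p : E3) 2) :=
    continuous_const.div cd cd0
  have cq2 : Continuous fun p : S2 => -(μ ^ 2 - 1) / lumpDenom μ ((p : E3) 2) ^ 2 :=
    continuous_const.div (cd.pow 2) fun p => pow_ne_zero 2 (cd0 p)
  have key : ∫ p : S2, ((μ ^ 2 - 1) ^ 2 * (1 - (p : E3) 2 ^ 2) / lumpDenom μ ((p : E3) 2) ^ 2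
      - Real.log (μ ^ 2)) ∂area ≤ 0 := by
    rw [← h]
    refine integral_mono (integrable_of_continuous (cF.sub continuous_const))
      (integrable_of_continuous (by fun_prop)) fun p => ?_
    have hs := height_mem_Icc p
    have h1 := log_lumpDenom_nonneg hμ hs
    have h2 := log_lumpDenom_le hμ hs
    have h3 : (μ ^ 2 - 1) ^ 2 * (1 - (p : E3) 2 ^ 2) / lumpDenom μ ((p : E3) 2) ^ 2
        + 2 * (p : E3) 2 * ((μ ^ 2 - 1) / lumpDenom μ ((p : E3) 2)) ≤ 1 := by
      have h4 := hd _ hs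
      have h5 : (μ ^ 2 - 1) ^ 2 * (1 - (p : E3) 2 ^ 2) / lumpDenom μ ((p : E3) 2) ^ 2
        + 2 * (p : E3) 2 * ((μ ^ 2 - 1) / lumpDenom μ ((p : E3) 2))
        = ((μ ^ 2 - 1) ^ 2 * (1 - (p : E3) 2 ^ 2)
          + 2 * (p : E3) 2 * (μ ^ 2 - 1) * lumpDenom μ ((p : E3) 2))
          / lumpDenom μ ((p : E3) 2) ^ 2 := by field_simp
      rw [h5, div_le_one (by positivity), lumpDenom_eq_affine]
      nlinarith [sq_nonneg μ]
    have h6 := mul_le_mul_of_nonneg_left h3 h1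
    simp only
    refine le_trans (sub_le_sub_left (h6.trans (by rw [mul_one]; exact h2)) _) (le_of_eq ?_)
    have h7 := cd0 p
    field_simp
    ring
  rw [integral_sub (integrable_of_continuous cF) (integrable_const _)] at key
  rw [integral_const, smul_eq_mul] at key
  linarith

end

/-! ### The test section and the limit of `τ`. -/

section

variable (μ : Set.Ioi (0 : ℝ))

theorem sphereSmooth_testFun : SphereSmooth fun p : S2 => testFun μ ((p : E3) 2) :=
  sphereSmooth_height_fun fun _ hs => contDiffAt_testFun (lumpDenom_pos μ.2 hs)

/-- The section of `φ^* TS²` for `φ = lump μ` along which the second variation is small. -/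
def testSection : SmoothSection (lump μ) :=
  (confSection (lump μ)).mulFun (sphereSmooth_testFun μ)

theorem testSection_mem_kerPerp : (testSection μ).jet ∈ kerPerp (lump μ) := by
  refine ⟨(testSection μ).jet_mem_H1, fun K hK => ?_⟩
  change ⟪(testSection μ).toL2, K.toL2⟫ = 0
  rw [SmoothSection.inner_toL2, ← integral_mul_inner_kernel hK
    (fun s hs => contDiffAt_testPrimitive (lumpDenom_pos μ.2 hs))
    (fun s hs => hasDerivAt_testPrimitive (lumpDenom_pos μ.2 hs))]
  congr 1
  funext p
  rw [lump_two, ← testFun_eq (lumpDenom_ne μ p)]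
  exact inner_smul_left _ _ _

theorem norm_sq_confSection (p : S2) : ‖(confSection (lump μ)).toFun p‖ ^ 2
    = (2 * (1 - (p : E3) 2) / lumpDenom μ ((p : E3) 2)) ^ 2 := by
  have h := lumpDenom_ne μ p
  refine (norm_sq_confField (lump μ p)).trans ?_
  rw [lump_two]
  congr 1
  field_simp
  rw [lumpDenom_eq_affine]
  ring

theorem hessian_testSection : hessian (testSection μ) (testSection μ)
    = ∫ p : S2, testFunDeriv μ ((p : E3) 2) ^ 2 * (1 - (p : E3) 2 ^ 2)
      * (2 * (1 - (p : E3) 2) / lumpDenom μ ((p : E3) 2)) ^ 2 ∂area := by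
  rw [testSection, hessian_mulFun (isHolomorphic_lump μ)
    (inKernel_confSection (isHolomorphic_lump μ))]
  congr 1
  funext p
  have hp := height_mem p
  have h1 : ∀ i, sder (fun p : S2 => testFun μ ((p : E3) 2)) p (basisVec i)
      = testFunDeriv μ ((p : E3) 2) * (basisVec i 2 - (p : E3) i * (p : E3) 2) := fun i => by
    rw [sder_height_fun (hasDerivAt_testFun (lumpDenom_pos μ.2 (height_mem_Icc p))),
      real_inner_comm, inner_basisVec]
  rw [norm_sq_confSection]
  congr 1
  simp only [h1, Fin.sum_univ_three]
  simp [basisVec]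
  linear_combination (testFunDeriv μ ((p : E3) 2) ^ 2 * (p : E3) 2 ^ 2) * hp

theorem area_real_univ_pos : 0 < area.real (Set.univ : Set S2) := by
  have h : area ≠ 0 := Measure.toSphere_ne_zero _
  have : NeZero area := ⟨h⟩
  exact measureReal_univ_pos

variable {μ}

theorem hessian_testSection_le (hμ : 1 < (μ : ℝ)) : hessian (testSection μ) (testSection μ)
    ≤ 14976 * (Real.log ((μ : ℝ) ^ 2))⁻¹ * area.real Set.univ := by
  have cd : Continuous fun p : S2 => lumpDenom μ ((p : E3) 2) :=
    (contDiff_lumpDenom μ).continuous.comp (by fun_prop)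
  have cF : Continuous fun p : S2 =>
      ((μ : ℝ) ^ 2 - 1) ^ 2 * (1 - (p : E3) 2 ^ 2) / lumpDenom μ ((p : E3) 2) ^ 2 :=
    Continuous.div (by fun_prop) (by fun_prop) fun p => pow_ne_zero 2 (lumpDenom_ne μ p)
  have hl := log_sq_pos hμ
  have hF := integral_log_gradient_le hμ
  rw [hessian_testSection]
  calc _ ≤ ∫ p : S2, (4608 * (Real.log ((μ : ℝ) ^ 2))⁻¹ + 10368 * (Real.log ((μ : ℝ) ^ 2))⁻¹ ^ 2
        * (((μ : ℝ) ^ 2 - 1) ^ 2 * (1 - (p : E3) 2 ^ 2) / lumpDenom μ ((p : E3) 2) ^ 2)) ∂area :=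
        integral_mono_of_nonneg (Eventually.of_forall fun p => by
          have := height_mem_Icc p
          have : 0 ≤ 1 - (p : E3) 2 ^ 2 := by nlinarith [this.1, this.2]
          positivity)
          (integrable_of_continuous (by fun_prop))
          (Eventually.of_forall fun p => testFunDeriv_sq_mul_le hμ (height_mem_Icc p))
    _ = 4608 * (Real.log ((μ : ℝ) ^ 2))⁻¹ * area.real Set.univ
        + 10368 * (Real.log ((μ : ℝ) ^ 2))⁻¹ ^ 2 * ∫ p : S2,
        ((μ : ℝ) ^ 2 - 1) ^ 2 * (1 - (p : E3) 2 ^ 2) / lumpDenom μ ((p : E3) 2) ^ 2 ∂area := by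
        rw [integral_add (integrable_const _)
          ((integrable_of_continuous cF).const_mul _), integral_const, integral_const_mul,
          smul_eq_mul]
        ring
    -- Since `ε² log μ² = ε`, both terms are of order `ε`, and `4608 + 10368 = 14976`.
    _ ≤ 4608 * (Real.log ((μ : ℝ) ^ 2))⁻¹ * area.real Set.univ
        + 10368 * (Real.log ((μ : ℝ) ^ 2))⁻¹ ^ 2
          * (area.real Set.univ * Real.log ((μ : ℝ) ^ 2)) := by gcongr
    _ = _ := by
        field_simp
        ring

theorem le_h1NormSq_testSection (hμ : 1 < (μ : ℝ)) :
    (16 - 768 * (Real.log ((μ : ℝ) ^ 2))⁻¹) * area.real Set.univ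
      ≤ h1NormSq (testSection μ).jet := by
  refine le_trans ?_ (integral_density_le_h1NormSq (testSection μ))
  have cw := continuous_lumpDensity μ
  have cd : Continuous fun p : S2 => lumpDenom μ ((p : E3) 2) :=
    (contDiff_lumpDenom μ).continuous.comp (by fun_prop)
  have cq : Continuous fun p : S2 => ((μ : ℝ) ^ 2 - 1 + ((μ : ℝ) ^ 2 + 1) * (p : E3) 2)
      / lumpDenom μ ((p : E3) 2) := Continuous.div (by fun_prop) cd (lumpDenom_ne μ)
  have cV := (testSection μ).sphereSmooth.continuous
  have h1 := integral_lumpDensity hμ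
  have h2 := integral_lumpDensity_mul hμ
  calc (16 - 768 * (Real.log ((μ : ℝ) ^ 2))⁻¹) * area.real Set.univ
      = ∫ p : S2, (16 * (lumpDensity μ ((p : E3) 2) - 2 * (lumpDensity μ ((p : E3) 2)
          * (((μ : ℝ) ^ 2 - 1 + ((μ : ℝ) ^ 2 + 1) * (p : E3) 2) / lumpDenom μ ((p : E3) 2))))
        - 768 * (Real.log ((μ : ℝ) ^ 2))⁻¹ * lumpDensity μ ((p : E3) 2)) ∂area := by
        rw [integral_sub (integrable_of_continuous (by fun_prop))
          (integrable_of_continuous (by fun_prop)), integral_const_mul, integral_const_mul,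
          integral_sub (integrable_of_continuous cw) (integrable_of_continuous (by fun_prop)),
          integral_const_mul, h1, h2]
        ring
    _ ≤ _ := by
        refine integral_mono (integrable_of_continuous (by fun_prop))
          (integrable_of_continuous (by fun_prop)) fun p => ?_
        have h3 : ‖(testSection μ).toFun p‖ ^ 2 = testFun μ ((p : E3) 2) ^ 2
            * (2 * (1 - (p : E3) 2) / lumpDenom μ ((p : E3) 2)) ^ 2 := by
          rw [← norm_sq_confSection]
          change ‖testFun μ ((p : E3) 2) • (confSection (lump μ)).toFun p‖ ^ 2 = _
          rw [norm_smul, mul_pow, Real.norm_eq_abs, sq_abs]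
        simp only [h3]
        exact le_density_mul_testFun_sq hμ (height_mem_Icc p)

theorem tau_lump_le (hμ : 1 < (μ : ℝ)) (hl : 96 ≤ Real.log ((μ : ℝ) ^ 2)) :
    tau (lump μ) ≤ ((1872 * (Real.log ((μ : ℝ) ^ 2))⁻¹ : ℝ) : EReal) := by
  have hA := area_real_univ_pos
  have h1 := hessian_testSection_le hμ
  have h2 := le_h1NormSq_testSection hμ
  have hε : (Real.log ((μ : ℝ) ^ 2))⁻¹ ≤ 1 / 96 := by
    rw [inv_eq_one_div]; gcongr
  have hε0 : 0 < (Real.log ((μ : ℝ) ^ 2))⁻¹ := inv_pos.2 (log_sq_pos hμ)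
  -- The threshold `96` makes `16 - 768 ε` at least `8`, and `14976 / 8 = 1872`.
  have h3 : 8 * area.real (Set.univ : Set S2) ≤ h1NormSq (testSection μ).jet := by nlinarith
  have hpos : 0 < h1NormSq (testSection μ).jet := by linarith
  have hne : (testSection μ).jet ≠ 0 := fun h => by simp [h, h1NormSq] at hpos
  refine (iInf₂_le _ ⟨testSection_mem_kerPerp μ, hne⟩).trans (EReal.coe_le_coe_iff.2 ?_)
  rw [hessianH1_jet, div_le_iff₀ hpos]
  nlinarith

theorem tendsto_tau_lump :
    Tendsto (fun μ : Set.Ioi (0 : ℝ) => tau (lump μ)) atTop (𝓝 (0 : EReal)) := by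
  have hlog : Tendsto (fun μ : Set.Ioi (0 : ℝ) => Real.log ((μ : ℝ) ^ 2)) atTop atTop :=
    tendsto_comp_val_Ioi_atTop.2
      (Real.tendsto_log_atTop.comp (tendsto_pow_atTop two_ne_zero))
  have hval : Tendsto (fun μ : Set.Ioi (0 : ℝ) => (μ : ℝ)) atTop atTop :=
    tendsto_comp_val_Ioi_atTop (f := fun x => x).2 tendsto_id
  have hb : Tendsto (fun μ : Set.Ioi (0 : ℝ) =>
      ((1872 * (Real.log ((μ : ℝ) ^ 2))⁻¹ : ℝ) : EReal)) atTop (𝓝 (0 : EReal)) := by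
    have h := (hlog.inv_tendsto_atTop).const_mul 1872
    rw [mul_zero] at h
    exact (continuous_coe_real_ereal.tendsto 0).comp h
  refine tendsto_of_tendsto_of_tendsto_of_le_of_le' tendsto_const_nhds hb
    (Eventually.of_forall fun μ => tau_lump_nonneg) ?_
  filter_upwards [hval.eventually_gt_atTop 1, hlog.eventually_ge_atTop 96] with μ h1 h2
  exact tau_lump_le h1 h2

theorem lump_mem_Rat1 (μ : Set.Ioi (0 : ℝ)) : lump μ ∈ Rat1 := by
  refine ⟨(μ : ℝ), 0, 0, 1, ?_, fun z _ => ?_⟩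
  · have : ((μ : ℝ) : ℂ) ≠ 0 := Complex.ofReal_ne_zero.2 (ne_of_gt μ.2)
    simpa using this
  · simpa using lump_ofStereo μ z

theorem le_tau {φ : SphereMap} {c : ℝ}
    (h : ∀ x ∈ kerPerp φ, c * h1NormSq x ≤ hessianH1 φ x) : (c : EReal) ≤ tau φ :=
  le_iInf₂ fun x hx => EReal.coe_le_coe_iff.2 <|
    (le_div_iff₀ (h1NormSq_pos hx.2)).2 (h x hx.1)

end

end LumpHessian

end

theorem theorem5p1 :
    Tendsto (fun μ : Set.Ioi (0 : ℝ) => LumpHessian.tau (LumpHessian.lump μ)) atTop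
      (𝓝 (0 : EReal)) ∧
    ¬ ∃ c : ℝ, 0 < c ∧ ∀ φ ∈ LumpHessian.Rat1, ∀ x ∈ LumpHessian.kerPerp φ,
      c * LumpHessian.h1NormSq x ≤ LumpHessian.hessianH1 φ x := by
  refine ⟨LumpHessian.tendsto_tau_lump, ?_⟩
  rintro ⟨c, hc, h⟩
  have h1 := LumpHessian.tendsto_tau_lump.eventually_lt_const
    (show (0 : EReal) < (c : EReal) from EReal.coe_pos.2 hc)
  obtain ⟨μ, hμ⟩ := h1.exists
  exact absurd (LumpHessian.le_tau (h _ (LumpHessian.lump_mem_Rat1 μ))) (not_le.2 hμ)
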